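/- Let $M_2(\mathbb{C})$ be the monoid of complex $2\times 2$ matrices, $M_2^0(\mathbb{C})$ its subsemigroup of singular matrices, and $\pi : M_2(\mathbb{C})\to PM_2(\mathbb{C}):=M_2(\mathbb{C})/\mathbb{C}^\times$ the quotient map. The class of a rank one matrix with image $v$ and kernel $u$ is written $(v,u)\in(\mathbb{C}P^1)^2$, and for $F,G\subseteq\mathbb{C}P^1$ put $B_{F,G}=\{(v,u): v\in F,\ u\in G\}\cup\{0\}$. A set of matrices is definable if, as a set of $4$-tuples of complex numbers, it is first-order definable with parameters in the field $\mathbb{C}$, in the language of rings; it is $\infty$-definable if it is the intersection of fewer than $2^{\aleph_0}$ definable sets. Idempotents are nonzero matrices $e$ with $e^2=e$; nilpotents are matrices $n$ with $n^2=0$. For $S\subseteq M_2(\mathbb{C})$ and a matrix $x$ let $Z_x=\{z\in\mathbb{C}^\times: zx\in S\}$. For $A\subseteq\mathbb{C}^\times$ let $A\,B_{F,G}$ be the set consisting of $0$ and all matrices $ze$ with $z\in A$ and $e$ an idempotent with $\pi(e)\in B_{F,G}$, and for a matrix $n$ let $A\cdot n=\{zn: z\in A\}$. Let $S$ be an $\infty$-definable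 subsemigroup of $M_2^0(\mathbb{C})$ such that $\pi(S)=B_{F,\{v\}}\cup B_{\{v\},G}$ for some $v\in\mathbb{C}P^1$ and $F,G\subseteq\mathbb{C}P^1$. Then: (1) If $G\not\subseteq\{v\}$, there is an idempotent $e\in S$ with $\pi(e)\in B_{\{v\},G}$; if $F\not\subseteq\{v\}$, there is an idempotent $f\in S$ with $\pi(f)\in B_{F,\{v\}}$. If $v\in F\cup G$, there is a nonzero nilpotent $n\in S$. Any two nonzero nilpotents in $S$ are multiples of each other by elements of $\mathbb{C}^\times$. (2) For all idempotents $e,f$ with $\pi(e)\in B_{\{v\},G}$ and $\pi(f)\in B_{F,\{v\}}$ and every nonzero nilpotent $n\in S$ (with $n=0$ instead if $v\notin F\cup G$), \[S=Z_e\,B_{\{v\},G\setminus\{v\}}\ \cup\ Z_f\,B_{F\setminus\{v\},\{v\}}\ \cup\ Z_n\cdot n .\] If $G\subseteq\{v\}$, the first term is $\{0\}$ and no $e$ is needed; if $F\subseteq\{v\}$, the second term is $\{0\}$ and no $f$ is needed. (3) $S$ is an intersection of fewer than $2^{\aleph_0}$ definable subsemigroups of $M_2^0(\mathbb{C})$.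 -/

import Mathlib

namespace TwoByTwo

/-- The monoid of `2 × 2` complex matrices. -/
abbrev M2 : Type := Matrix (Fin 2) (Fin 2) ℂ

/-- The semigroup of singular `2 × 2` complex matrices. -/
def M20 : Subsemigroup M2 where
  carrier := {x | x.det = 0}
  mul_mem' := by
    intro a b ha _
    have ha' : a.det = 0 := ha
    show (a * b).det = 0
    rw [Matrix.det_mul, ha', zero_mul]

/-- `X` is definable (with parameters from `ℂ`) in the field `ℂ`, in the first-order language of
rings; a matrix is read as the tuple of its four entries. -/
def IsDefinable (X : Set M2) : Prop :=
  letI := FirstOrder.Ring.compatibleRingOfRing ℂ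
  (Set.univ : Set ℂ).Definable FirstOrder.Language.ring
    {w : Fin 2 × Fin 2 → ℂ | (Matrix.of fun i j => w (i, j)) ∈ X}

/-- `X` is `∞`-definable: the intersection of a small family of definable sets. As usual for a
saturated structure, small means of cardinality less than that of the structure, here less than the
continuum. (Without smallness every subset of `M2` would qualify.) -/
def IsInftyDefinable (X : Set M2) : Prop :=
  ∃ (ι : Type) (Y : ι → Set M2), Cardinal.mk ι < Cardinal.continuum ∧
    (∀ i, IsDefinable (Y i)) ∧ X = ⋂ i, Y i

/-- `PM2 = M2 / ℂ^×`. -/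
abbrev PM2 : Type := MulAction.orbitRel.Quotient ℂˣ M2

/-- The natural surjection `π : M2 → PM2`. -/
def proj (x : M2) : PM2 := Quotient.mk (MulAction.orbitRel ℂˣ M2) x

/-- The complex projective line, the set of lines in `ℂ²`. -/
abbrev P1 : Type := Projectivization ℂ (Fin 2 → ℂ)

/-- `x` has rank one, its image is the line `v` and its kernel is the line `u`; that is, `π x` is
the pair `(v, u)`. -/
def HasImageKernel (x : M2) (v u : P1) : Prop :=
  LinearMap.range (Matrix.toLin' x) = v.submodule ∧ LinearMap.ker (Matrix.toLin' x) = u.submodule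

/-- `B F G = {(v, u) : v ∈ F, u ∈ G} ∪ {0}` in `PM2`, where `(v, u)` is the class of the rank one
matrices with image `v` and kernel `u`. -/
def B (F G : Set P1) : Set PM2 :=
  insert (proj 0) {p | ∃ x : M2, ∃ v ∈ F, ∃ u ∈ G, HasImageKernel x v u ∧ p = proj x}

/-- Nonzero idempotent (zero is not counted as an idempotent). -/
def IsIdem (e : M2) : Prop := e ≠ 0 ∧ e * e = e

/-- Nilpotent (zero is counted as a nilpotent). -/
def IsNil (n : M2) : Prop := n * n = 0

/-- The multiplicity `Z_x = {z ∈ ℂ^× : z x ∈ S}`. -/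
def Z (S : Set M2) (x : M2) : Set ℂ := {z | z ≠ 0 ∧ z • x ∈ S}

/-- `A · B_{F,G}`, for a set of scalars `A`: zero and the multiples, by scalars in `A`, of the
idempotent matrices whose class lies in `B F G`. -/
def scaledB (A : Set ℂ) (F G : Set P1) : Set M2 :=
  insert 0 {x | ∃ z ∈ A, ∃ e : M2, IsIdem e ∧ proj e ∈ B F G ∧ x = z • e}

end TwoByTwo

open TwoByTwo

/-! Choose a basis `P` whose first vector spans `v`. In it the rank one matrices with image `v` or
kernel `v` are the nonzero multiples of E_γ = [[1, -γ], [0, 0]] (`idemLeft`), F_φ = [[0, φ], [0, 1]]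
(`idemRight`) and N = [[0, 1], [0, 0]] (`nilp`). The E_γ absorb one another from the right and the
F_φ from the left, F_φ E_γ = 0, and the one product relating the parameters is E_γ F_φ = (φ - γ) N.

Definability enters only through traces on affine lines. By Chevalley's theorem a definable set is
constructible, so it meets a line in a finite or cofinite set; hence an `∞`-definable set meets it
in a finite set or in one whose complement has fewer than continuum many elements
(`isFiniteOrCosmall_line`). A multiplicative semigroup of nonzero scalars of this kind is a finite
group or all of ℂ^×. Thus S contains an idempotent as soon as it contains a nonzero multiple of it,
and by absorption the scalars allowed on E_γ form a group A independent of γ; likewise a group B for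
the F_φ. So S is given by A, B, the sets G, F of slopes and the set C of scalars on N, with AC ⊆ C,
BC ⊆ C and F - G ⊆ C (`exists_eq_triangular`). This yields (1) and (2).

For (3), C is approximated from outside by finite or cofinite sets stable under A and B, and G, F
are enlarged so that F - G ⊆ C survives (`exists_isFiniteOrCofinite_sub_mem`). -/

open MvPolynomial PrimeSpectrum Topology in
/-- In the spectrum of a Jacobson ring every nonempty constructible set has a closed point. -/
theorem Topology.IsConstructible.nonempty_inter_closedPoints {R : Type*} [CommRing R]
    [IsJacobsonRing R] {s : Set (PrimeSpectrum R)} (hs : IsConstructible s) (hne : s.Nonempty) :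
    (s ∩ closedPoints (PrimeSpectrum R)).Nonempty := by
  induction s, hs using IsConstructible.induction_of_isTopologicalBasis
    (fun f : R ↦ (basicOpen f : Set (PrimeSpectrum R))) isTopologicalBasis_basic_opens
    (fun f ↦ isCompact_basicOpen f) with
  | sdiff i s hs =>
    -- A basic open set minus finitely many others is locally closed, where the Jacobson property
    -- supplies closed points.
    refine _root_.nonempty_inter_closedPoints hne ?_
    rw [sdiff_eq]
    refine (basicOpen i).2.isLocallyClosed.inter ?_
    refine (isOpen_biUnion fun j _ ↦ (basicOpen j).2).isClosed_compl.isLocallyClosed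
  | union s hs t ht ihs iht =>
    rcases hne with ⟨x, hx | hx⟩
    · exact (ihs ⟨x, hx⟩).mono (Set.inter_subset_inter_left _ Set.subset_union_left)
    · exact (iht ⟨x, hx⟩).mono (Set.inter_subset_inter_left _ Set.subset_union_right)

/-! ### Constructible sets of points in affine space -/

namespace AffineConstructible

open MvPolynomial PrimeSpectrum Topology

variable {K : Type*} [Field K] {σ τ : Type*}

/-- A set of points of affine space that is the trace of a constructible set of the spectrum. -/
def IsConstructibleSet (E : Set (σ → K)) : Prop :=
  ∃ s : Set (PrimeSpectrum (MvPolynomial σ K)), IsConstructible s ∧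
    ∀ u, u ∈ E ↔ pointToPoint (k := K) u ∈ s

theorem IsConstructibleSet.compl {E : Set (σ → K)} (h : IsConstructibleSet E) :
    IsConstructibleSet Eᶜ := by
  obtain ⟨s, hs, h⟩ := h
  exact ⟨sᶜ, hs.compl, fun u ↦ by simp [h]⟩

theorem IsConstructibleSet.union {E E' : Set (σ → K)} (h : IsConstructibleSet E)
    (h' : IsConstructibleSet E') : IsConstructibleSet (E ∪ E') := by
  obtain ⟨s, hs, h⟩ := h
  obtain ⟨s', hs', h'⟩ := h'
  exact ⟨s ∪ s', hs.union hs', fun u ↦ by simp [h, h']⟩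

theorem isConstructibleSet_empty : IsConstructibleSet (∅ : Set (σ → K)) :=
  ⟨∅, .empty, by simp⟩

theorem mem_pointToPoint {u : σ → K} {p : MvPolynomial σ K} :
    p ∈ (pointToPoint (k := K) u).asIdeal ↔ aeval u p = 0 :=
  mem_vanishingIdeal_singleton_iff _ _

theorem isConstructibleSet_zero (p : MvPolynomial σ K) :
    IsConstructibleSet {u : σ → K | aeval u p = 0} :=
  ⟨(basicOpen p : Set _)ᶜ, isConstructible_basicOpen.compl, fun u ↦ by
    simp [mem_pointToPoint]⟩

theorem comap_rename_pointToPoint (r : σ → τ) (u : τ → K) :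
    comap (rename r : MvPolynomial σ K →ₐ[K] MvPolynomial τ K).toRingHom
      (pointToPoint (k := K) u) = pointToPoint (u ∘ r) := by
  ext p
  rw [mem_pointToPoint, comap_asIdeal, Ideal.mem_comap, mem_pointToPoint]
  simp [aeval_rename]

theorem eq_of_pointToPoint_eq {u w : σ → K}
    (h : pointToPoint (k := K) u = pointToPoint w) : u = w := by
  funext i
  have h1 : (X i - C (w i)) ∈ (pointToPoint (k := K) w).asIdeal := by simp [mem_pointToPoint]
  rw [← h, mem_pointToPoint] at h1
  simpa [sub_eq_zero] using h1

theorem isMaximal_pointToPoint [IsAlgClosed K] [Finite σ] (u : σ → K) :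
    (pointToPoint (k := K) u).asIdeal.IsMaximal :=
  isMaximal_iff_eq_vanishingIdeal_singleton.2 ⟨u, rfl⟩

/-- Chevalley's theorem for the points of affine spaces over an algebraically closed field. -/
theorem IsConstructibleSet.image_comp [IsAlgClosed K] [Finite σ] [Finite τ] (r : σ → τ)
    {E : Set (τ → K)} (h : IsConstructibleSet E) :
    IsConstructibleSet {w : σ → K | ∃ u ∈ E, u ∘ r = w} := by
  obtain ⟨s, hs, h⟩ := h
  set f := (rename r : MvPolynomial σ K →ₐ[K] MvPolynomial τ K).toRingHom with hf
  have hfp : f.FinitePresentation := by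
    rw [← RingHom.FinitePresentation.of_finiteType]
    refine RingHom.FiniteType.of_comp_finiteType (f := (C : K →+* MvPolynomial σ K)) ?_
    have : f.comp C = (C : K →+* MvPolynomial τ K) := by
      ext; simp [hf]
    rw [this, ← MvPolynomial.algebraMap_eq, RingHom.finiteType_algebraMap]
    infer_instance
  refine ⟨_, isConstructible_comap_image hfp hs, fun w ↦ ⟨?_, ?_⟩⟩
  · rintro ⟨u, hu, rfl⟩
    exact ⟨_, (h u).1 hu, comap_rename_pointToPoint r u⟩
  · rintro ⟨q, hq, hqw⟩
    -- The point `q` over `w` need not be closed. But the fibre over `w` is closed, so its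
    -- intersection with `s` is constructible and has a closed point, which comes from a tuple by
    -- the Nullstellensatz.
    have hcl : IsClosed {pointToPoint (k := K) w} :=
      (isClosed_singleton_iff_isMaximal _).2 (isMaximal_pointToPoint w)
    have hpre := hcl.preimage (continuous_comap f)
    have hop := hpre.isOpen_compl
    have hc : IsConstructible ((comap f) ⁻¹' {pointToPoint (k := K) w}) :=
      ((TopologicalSpace.NoetherianSpace.isCompact _).isConstructible hop).of_compl
    obtain ⟨m, ⟨hm, hmw⟩, hmcl⟩ := (hs.inter hc).nonempty_inter_closedPoints ⟨q, hq, hqw⟩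
    rw [mem_closedPoints_iff, isClosed_singleton_iff_isMaximal] at hmcl
    obtain ⟨u, hu⟩ := isMaximal_iff_eq_vanishingIdeal_singleton.1 hmcl
    have hmu : m = pointToPoint (k := K) u := PrimeSpectrum.ext hu
    subst hmu
    refine ⟨u, (h u).2 hm, eq_of_pointToPoint_eq ?_⟩
    rw [← comap_rename_pointToPoint]
    exact hmw

/-- A constructible set meets an affine line in a finite or a cofinite set. -/
theorem IsConstructibleSet.finite_or_finite_compl_line {E : Set (σ → K)}
    (h : IsConstructibleSet E) (x y : σ → K) :
    {z : K | x + z • y ∈ E}.Finite ∨ {z : K | x + z • y ∈ E}ᶜ.Finite := by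
  obtain ⟨s, hs, h⟩ := h
  simp only [h]
  clear h E
  induction hs using IsConstructible.empty_union_induction with
  | open_retrocompact U hU _ =>
    obtain ⟨t, ht⟩ := (isClosed_iff_zeroLocus _).1 hU.isClosed_compl
    let l : MvPolynomial σ K →ₐ[K] Polynomial K :=
      aeval fun i ↦ Polynomial.C (x i) + Polynomial.X * Polynomial.C (y i)
    have hl (z : K) (p) : (l p).eval z = aeval (x + z • y) p := by
      have : (Polynomial.aeval z).comp l = aeval (x + z • y) := by
        ext i
        simpa [l] using mul_comm _ _
      rw [← this, AlgHom.comp_apply, Polynomial.coe_aeval_eq_eval]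
    have hU' (z : K) : pointToPoint (k := K) (x + z • y) ∈ U ↔ ∃ p ∈ t, (l p).eval z ≠ 0 := by
      rw [← not_iff_not, ← Set.mem_compl_iff, ht, mem_zeroLocus]
      simp only [Set.subset_def, SetLike.mem_coe, mem_pointToPoint, hl]
      push Not
      rfl
    simp only [hU']
    -- Here `l` restricts polynomials to the line. If one restriction is nonzero, the line leaves
    -- `U` only at its roots; otherwise the line misses `U`.
    by_cases hp : ∃ p ∈ t, l p ≠ 0
    · obtain ⟨p, hp, hp0⟩ := hp
      right
      refine (Polynomial.finite_setOfPred_isRoot hp0).subset fun z hz ↦ ?_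
      by_contra h
      exact hz ⟨p, hp, h⟩
    · left
      push Not at hp
      convert Set.finite_empty
      ext z
      simp only [Set.mem_ofPred_eq, Set.mem_empty_iff_false, iff_false]
      rintro ⟨p, hpt, h⟩
      simp [hp p hpt] at h
  | union s hs t ht ihs iht =>
    rcases ihs with h1 | h1
    · rcases iht with h2 | h2
      · left
        exact (h1.union h2)
      · right
        exact h2.subset fun z hz h ↦ hz (Or.inr h)
    · right
      exact h1.subset fun z hz h ↦ hz (Or.inl h)
  | compl s hs ih =>
    rcases ih with h | h
    · right
      exact h.subset fun z hz ↦ by simpa using hz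
    · left
      exact h

end AffineConstructible

/-! ### Definable sets are constructible -/

namespace AffineConstructible

open MvPolynomial FirstOrder FirstOrder.Language FirstOrder.Ring

variable {K : Type*} [Field K] [CompatibleRing K] {α β : Type*}

theorem exists_aeval_eq_realize (θ : β → MvPolynomial α K) {n : ℕ}
    (t : Language.ring.Term (β ⊕ Fin n)) :
    ∃ p : MvPolynomial (α ⊕ Fin n) K, ∀ w : α ⊕ Fin n → K,
      t.realize (Sum.elim (fun b ↦ aeval (w ∘ Sum.inl) (θ b)) (w ∘ Sum.inr)) = aeval w p := by
  induction t with
  | var i =>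
    rcases i with b | i
    · exact ⟨rename Sum.inl (θ b), fun w ↦ by simp [aeval_rename]⟩
    · exact ⟨X (Sum.inr i), fun w ↦ by simp⟩
  | func f ts ih =>
    choose p hp using ih
    simp only [Term.realize_func, hp]
    cases f with
    | add => exact ⟨p 0 + p 1, fun w ↦ by simp⟩
    | mul => exact ⟨p 0 * p 1, fun w ↦ by simp⟩
    | neg => exact ⟨- p 0, fun w ↦ by simp⟩
    | zero => exact ⟨0, fun w ↦ by simp⟩
    | one => exact ⟨1, fun w ↦ by simp⟩

/-- Quantifier elimination by induction on the formula. The substitution `θ` turns parameters into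
constants, because Chevalley's theorem needs finitely many variables while there may be infinitely
many parameters. -/
theorem isConstructibleSet_realize [IsAlgClosed K] [Finite α] (θ : β → MvPolynomial α K) {n : ℕ}
    (φ : Language.ring.BoundedFormula β n) :
    IsConstructibleSet {w : α ⊕ Fin n → K |
      φ.Realize (fun b ↦ aeval (w ∘ Sum.inl) (θ b)) (w ∘ Sum.inr)} := by
  induction φ with
  | falsum => exact isConstructibleSet_empty
  | equal t₁ t₂ =>
    obtain ⟨p, hp⟩ := exists_aeval_eq_realize θ t₁
    obtain ⟨q, hq⟩ := exists_aeval_eq_realize θ t₂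
    convert isConstructibleSet_zero (p - q) using 1
    ext w
    simp only [Set.mem_ofPred_eq, map_sub, sub_eq_zero, ← hp, ← hq]
    exact Iff.rfl
  | rel R _ => exact R.elim
  | imp φ ψ ihφ ihψ =>
    convert ihφ.compl.union ihψ using 1
    ext w
    simp [imp_iff_not_or]
  | @all n φ ih =>
    -- A universal quantifier is the complement of the projection of the complement, forgetting the
    -- last bound variable.
    convert (ih.compl.image_comp (Sum.map id Fin.castSucc)).compl using 1
    ext w
    simp only [Set.mem_ofPred_eq, BoundedFormula.realize_all, Set.mem_compl_iff, not_exists, not_and]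
    constructor
    · rintro h u hu rfl
      refine hu ?_
      have hsnoc : u ∘ Sum.inr = Fin.snoc ((u ∘ Sum.map id Fin.castSucc) ∘ Sum.inr)
          (u (Sum.inr (Fin.last n))) := by
        funext i
        refine Fin.lastCases ?_ (fun i ↦ ?_) i <;> simp
      have := h (u (Sum.inr (Fin.last n)))
      rwa [← hsnoc] at this
    · intro h a
      by_contra hc
      refine h (Sum.elim (w ∘ Sum.inl) (Fin.snoc (w ∘ Sum.inr) a)) (fun h' ↦ hc h') ?_
      · ext (i | i) <;> simp

/-- A definable subset of affine space over an algebraically closed field is constructible. -/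
theorem isConstructibleSet_of_definable [IsAlgClosed K] [Finite α] {A : Set K} {E : Set (α → K)}
    (h : A.Definable Language.ring E) : IsConstructibleSet E := by
  obtain ⟨φ, rfl⟩ := Set.definable_iff_exists_formula_sum.1 h
  have := (isConstructibleSet_realize (Sum.elim (fun a : A ↦ C (a : K)) X) φ).image_comp
    (Sum.inl : α → α ⊕ Fin 0)
  convert this using 1
  ext w
  have key (u : α ⊕ Fin 0 → K) :
      (fun b ↦ aeval (u ∘ Sum.inl) (Sum.elim (fun a : A ↦ C (a : K)) X b)) =
        Sum.elim (fun a : A ↦ (a : K)) (u ∘ Sum.inl) := by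
    ext (b | b) <;> simp
  simp only [Set.mem_ofPred_eq, key]
  constructor
  · intro h
    exact ⟨Sum.elim w Fin.elim0, (Iff.of_eq (by unfold Formula.Realize; congr!)).1 h, rfl⟩
  · rintro ⟨u, hu, rfl⟩
    exact (Iff.of_eq (by unfold Formula.Realize; congr!)).1 hu

end AffineConstructible

/-! ### Definable sets of matrices -/

namespace TwoByTwo

open AffineConstructible FirstOrder

variable {X Y : Set M2}

theorem IsDefinable.finite_or_finite_compl_line (h : IsDefinable Y) (x y : M2) :
    {z : ℂ | x + z • y ∈ Y}.Finite ∨ {z : ℂ | x + z • y ∈ Y}ᶜ.Finite := by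
  let := FirstOrder.Ring.compatibleRingOfRing ℂ
  have := (isConstructibleSet_of_definable h).finite_or_finite_compl_line
    (fun ij ↦ x ij.1 ij.2) (fun ij ↦ y ij.1 ij.2)
  exact this

theorem IsDefinable.inter (hX : IsDefinable X) (hY : IsDefinable Y) : IsDefinable (X ∩ Y) := by
  let := FirstOrder.Ring.compatibleRingOfRing ℂ
  exact Set.Definable.inter hX hY

theorem IsDefinable.union (hX : IsDefinable X) (hY : IsDefinable Y) : IsDefinable (X ∪ Y) := by
  let := FirstOrder.Ring.compatibleRingOfRing ℂ
  exact Set.Definable.union hX hY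

theorem IsDefinable.compl (hX : IsDefinable X) : IsDefinable Xᶜ := by
  let := FirstOrder.Ring.compatibleRingOfRing ℂ
  exact Set.Definable.compl hX

theorem isDefinable_empty : IsDefinable ∅ := by
  let := FirstOrder.Ring.compatibleRingOfRing ℂ
  exact Set.definable_empty

theorem isDefinable_fiber (l : M2 →ₗ[ℂ] ℂ) (c : ℂ) : IsDefinable {x | l x = c} := by
  let := FirstOrder.Ring.compatibleRingOfRing ℂ
  let p : MvPolynomial (Fin 2 × Fin 2) ℂ :=
    ∑ ij, MvPolynomial.C (l (Matrix.single ij.1 ij.2 1)) * MvPolynomial.X ij - MvPolynomial.C c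
  have h := (FirstOrder.Ring.mvPolynomial_zeroLocus_definable {p}).mono (Set.subset_univ _)
  rw [MvPolynomial.zeroLocus_span] at h
  unfold IsDefinable
  convert h using 1
  ext w
  have : l (Matrix.of fun i j ↦ w (i, j)) - c = MvPolynomial.aeval w p := by
    rw [Matrix.matrix_eq_sum_single (Matrix.of fun i j ↦ w (i, j)), ← Finset.sum_product']
    simp only [p, map_sum, map_mul, map_sub, MvPolynomial.aeval_C, MvPolynomial.aeval_X]
    congr 1
    refine Finset.sum_congr (by simp) fun ij _ ↦ ?_
    have : Matrix.single ij.1 ij.2 (w ij) = w ij • Matrix.single ij.1 ij.2 (1 : ℂ) := by simp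
    simp only [Matrix.of_apply, Prod.mk.eta]
    rw [this, map_smul, smul_eq_mul, mul_comm]
    rfl
  rw [MvPolynomial.aeval_eq_eval] at this
  simp [← this, sub_eq_zero]

theorem isDefinable_biUnion {ι : Type*} {s : Set ι} (hs : s.Finite) {Y : ι → Set M2}
    (h : ∀ i ∈ s, IsDefinable (Y i)) : IsDefinable (⋃ i ∈ s, Y i) := by
  induction s, hs using Set.Finite.induction_on with
  | empty => simpa using isDefinable_empty
  | insert _ _ ih =>
    rw [Set.biUnion_insert]
    exact (h _ (Set.mem_insert _ _)).union (ih fun i hi ↦ h i (Set.mem_insert_of_mem _ hi))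

end TwoByTwo

/-! ### Finite or cofinite sets -/

/-- Finite or cofinite. -/
def Set.IsFiniteOrCofinite {α : Type*} (X : Set α) : Prop := X.Finite ∨ Xᶜ.Finite

namespace Set.IsFiniteOrCofinite

variable {α β : Type*} {X Y : Set α}

theorem inter (hX : X.IsFiniteOrCofinite) (hY : Y.IsFiniteOrCofinite) :
    (X ∩ Y).IsFiniteOrCofinite := by
  rcases hX with hX | hX
  · exact .inl (hX.subset Set.inter_subset_left)
  · rcases hY with hY | hY
    · exact .inl (hY.subset Set.inter_subset_right)
    · right
      rw [Set.compl_inter]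
      exact hX.union hY

theorem univ : (Set.univ : Set α).IsFiniteOrCofinite := .inr (by simp)

theorem preimage {f : β → α} (hX : X.IsFiniteOrCofinite) (hf : f.Injective) :
    (f ⁻¹' X).IsFiniteOrCofinite :=
  hX.imp (fun h ↦ h.preimage hf.injOn) (fun h ↦ h.preimage hf.injOn)

theorem biInter {ι : Type*} {s : Set ι} (hs : s.Finite) {X : ι → Set α}
    (h : ∀ i ∈ s, (X i).IsFiniteOrCofinite) : (⋂ i ∈ s, X i).IsFiniteOrCofinite := by
  induction s, hs using Set.Finite.induction_on with
  | empty => simpa using univ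
  | insert _ _ ih =>
    rw [Set.biInter_insert]
    exact (h _ (Set.mem_insert _ _)).inter (ih fun i hi ↦ h i (Set.mem_insert_of_mem _ hi))

end Set.IsFiniteOrCofinite

/-! ### Finite or cosmall sets of complex numbers -/

open Cardinal

/-- A set of complex numbers that is finite or whose complement has fewer than continuum many
elements. -/
def IsFiniteOrCosmall (X : Set ℂ) : Prop := X.Finite ∨ #↥Xᶜ < 𝔠

namespace IsFiniteOrCosmall

variable {X Y : Set ℂ}

/-- The complements of `X` and of the translate of `Y` by `c` are too small to cover ℂ together. -/
theorem exists_mem_sub_mem (hX : #↥Xᶜ < 𝔠) (hY : #↥Yᶜ < 𝔠) (c : ℂ) :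
    ∃ x ∈ X, x - c ∈ Y := by
  by_contra! h
  have hsub : (Set.univ : Set ℂ) ⊆ Xᶜ ∪ (· + c) '' Yᶜ := fun x _ ↦ by
    by_cases hx : x ∈ X
    · exact .inr ⟨x - c, h x hx, by simp⟩
    · exact .inl hx
  have h1 := (mk_le_mk_of_subset hsub).trans (mk_union_le _ _)
  rw [mk_univ, Cardinal.mk_complex] at h1
  exact (add_lt_of_lt aleph0_le_continuum hX (mk_image_le.trans_lt hY)).not_ge h1

/-- A subsemigroup of the nonzero complex numbers that is finite or cosmall is a finite group or
everything. -/
theorem inv_mem_or_forall_mem (hX : IsFiniteOrCosmall X) (hmul : ∀ x ∈ X, ∀ y ∈ X, x * y ∈ X) :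
    (X.Finite ∧ ∀ x ∈ X, x ≠ 0 → 1 ∈ X ∧ x⁻¹ ∈ X) ∨ ∀ x ≠ 0, x ∈ X := by
  refine hX.imp (fun hX ↦ ⟨hX, fun x hx hx0 ↦ ?_⟩) fun hX c hc ↦ ?_
  · have hpow (k : ℕ) : x ^ (k + 1) ∈ X := by
      induction k with
      | zero => simpa
      | succ k ih => rw [pow_succ]; exact hmul _ ih _ hx
    -- In a finite set two positive powers of `x` coincide, so `x ^ (k + 1) = 1` for some `k`, and
    -- the inverse is `x ^ k`.
    obtain ⟨i, j, hij, h⟩ : ∃ i j : ℕ, i < j ∧ x ^ (i + 1) = x ^ (j + 1) := by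
      have hni : ¬ Function.Injective fun k : ℕ ↦ (⟨x ^ (k + 1), hpow k⟩ : X) := fun h ↦ by
        have := hX.to_subtype
        exact not_injective_infinite_finite _ h
      rw [Function.Injective] at hni
      push Not at hni
      obtain ⟨i, j, h, hne⟩ := hni
      have h := congrArg Subtype.val h
      rcases hne.lt_or_gt with hlt | hlt
      · exact ⟨i, j, hlt, h⟩
      · exact ⟨j, i, hlt, h.symm⟩
    obtain ⟨k, rfl⟩ := Nat.exists_eq_add_of_lt hij
    have h1 : x ^ (k + 1) = 1 := by
      rw [show i + k + 1 + 1 = (i + 1) + (k + 1) by ring, pow_add x (i + 1)] at h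
      exact (mul_eq_left₀ (pow_ne_zero _ hx0)).1 h.symm
    have hone : 1 ∈ X := h1 ▸ hpow k
    refine ⟨hone, ?_⟩
    rw [← eq_inv_of_mul_eq_one_left (a := x ^ k) (b := x) (by rw [← pow_succ, h1])]
    cases k with
    | zero => simpa
    | succ k => exact hpow k
  · by_contra hcX
    -- If `c` is not in `X`, then in each factorization `c = x * (c * x⁻¹)` one factor lies outside
    -- `X`, so two small sets and 0 would cover ℂ.
    have hsub : (Set.univ : Set ℂ) ⊆ (Xᶜ ∪ (fun y ↦ c * y⁻¹) '' Xᶜ) ∪ {0} := fun x _ ↦ by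
      by_cases hx0 : x = 0
      · exact .inr hx0
      by_cases hx : x ∈ X
      · refine .inl (.inr ⟨c * x⁻¹, fun h ↦ hcX ?_, by field_simp⟩)
        simpa [mul_assoc, hx0] using hmul _ h _ hx
      · exact .inl (.inl hx)
    have h1 := (mk_le_mk_of_subset hsub).trans ((mk_union_le _ _).trans
      (add_le_add_left (mk_union_le _ _) _))
    rw [mk_univ, Cardinal.mk_complex] at h1
    refine (add_lt_of_lt aleph0_le_continuum
      (add_lt_of_lt aleph0_le_continuum hX (mk_image_le.trans_lt hX)) ?_).not_ge h1
    rw [mk_singleton]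
    exact one_lt_aleph0.trans_le aleph0_le_continuum

/-- A finite set is the intersection of a one-element family, a cosmall set the intersection of
the sets obtained by removing something around each point of its complement. -/
theorem exists_family (hX : IsFiniteOrCosmall X) (p : Set ℂ → Prop) (hp : p Set.univ)
    (hfin : X.Finite → p X) (hcompl : ∀ x ∉ X, ∃ Y, p Y ∧ X ⊆ Y ∧ x ∉ Y) :
    ∃ (κ : Type) (Y : κ → Set ℂ), #κ < 𝔠 ∧ Nonempty κ ∧ (∀ i, p (Y i)) ∧ X = ⋂ i, Y i := by
  rcases hX with hX | hX
  · refine ⟨Unit, fun _ ↦ X, ?_, inferInstance, fun _ ↦ hfin hX, by simp [Set.iInter_const]⟩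
    exact (mk_eq_one Unit).trans_lt (one_lt_aleph0.trans_le aleph0_le_continuum)
  · choose! Y hY using hcompl
    -- The extra index `none` keeps the family nonempty when `X` is everything.
    refine ⟨Option ↥Xᶜ, fun o ↦ o.elim Set.univ fun x ↦ Y x, ?_, inferInstance, ?_, ?_⟩
    · rw [mk_option]
      exact add_lt_of_lt aleph0_le_continuum hX (one_lt_aleph0.trans_le aleph0_le_continuum)
    · rintro (_ | x)
      · exact hp
      · exact (hY x x.2).1
    · refine Set.Subset.antisymm (Set.subset_iInter ?_) fun x hx ↦ ?_
      · rintro (_ | x)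
        · exact Set.subset_univ _
        · exact (hY x x.2).2.1
      · by_contra h
        exact (hY x h).2.2 (Set.mem_iInter.1 hx (some ⟨x, h⟩))

end IsFiniteOrCosmall

/-! ### Traces of `∞`-definable sets on lines -/

namespace TwoByTwo

/-- Either one set of the family has a finite trace, or every trace omits finitely many points, and
a union of fewer than 𝔠 finite sets has fewer than 𝔠 elements. -/
theorem IsInftyDefinable.isFiniteOrCosmall_line {X : Set M2} (h : IsInftyDefinable X) (x y : M2) :
    IsFiniteOrCosmall {z : ℂ | x + z • y ∈ X} := by
  obtain ⟨ι, Y, hι, hY, rfl⟩ := h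
  by_cases hfin : ∃ i, {z : ℂ | x + z • y ∈ Y i}.Finite
  · obtain ⟨i, hi⟩ := hfin
    exact .inl (hi.subset fun z hz ↦ Set.mem_iInter.1 hz i)
  · right
    push Not at hfin
    have hc (i) := ((hY i).finite_or_finite_compl_line x y).resolve_left (hfin i)
    have : {z : ℂ | x + z • y ∈ ⋂ i, Y i}ᶜ = ⋃ i, {z : ℂ | x + z • y ∈ Y i}ᶜ := by
      ext z; simp
    rw [this]
    refine (mk_iUnion_le_sum_mk.trans (sum_le_mk_mul_iSup _)).trans_lt ?_
    refine mul_lt_of_lt aleph0_le_continuum hι ((ciSup_le' fun i ↦ ?_).trans_lt aleph0_lt_continuum)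
    exact (hc i).lt_aleph0.le

end TwoByTwo

/-! ### Triangular semigroups in a frame -/

namespace TwoByTwo

open Cardinal

/-- The idempotents with image the first basis line, in the frame `P`. -/
def idemLeft (P : M2ˣ) (γ : ℂ) : M2 := P.val * !![1, -γ; 0, 0] * P.inv

/-- The idempotents with kernel the first basis line, in the frame `P`. -/
def idemRight (P : M2ˣ) (φ : ℂ) : M2 := P.val * !![0, φ; 0, 1] * P.inv

/-- The nilpotent with image and kernel the first basis line, in the frame `P`. -/
def nilp (P : M2ˣ) : M2 := P.val * !![0, 1; 0, 0] * P.inv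

variable (P : M2ˣ)

theorem conj_mul_conj (x y : M2) :
    P.val * x * P.inv * (P.val * y * P.inv) = P.val * (x * y) * P.inv := by
  simp only [mul_assoc]
  rw [← mul_assoc P.inv P.val, P.inv_val, one_mul]

theorem matrix_zero : (!![0, 0; 0, 0] : M2) = 0 := by
  ext i j
  fin_cases i <;> fin_cases j <;> rfl

theorem idemLeft_mul_idemLeft (γ γ' : ℂ) : idemLeft P γ * idemLeft P γ' = idemLeft P γ' := by
  rw [idemLeft, idemLeft, conj_mul_conj, Matrix.mul_fin_two]
  simp

theorem idemRight_mul_idemRight (φ φ' : ℂ) :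
    idemRight P φ * idemRight P φ' = idemRight P φ := by
  rw [idemRight, idemRight, conj_mul_conj, Matrix.mul_fin_two]
  simp

/-- The one product that ties the slopes to the nilpotent scalars; it is the source of the condition
`φ - γ ∈ C`. -/
theorem idemLeft_mul_idemRight (γ φ : ℂ) :
    idemLeft P γ * idemRight P φ = (φ - γ) • nilp P := by
  rw [idemLeft, idemRight, nilp, conj_mul_conj, ← smul_mul_assoc, ← mul_smul_comm,
    Matrix.mul_fin_two]
  simp [sub_eq_add_neg, Matrix.smul_of]

theorem idemRight_mul_idemLeft (γ φ : ℂ) : idemRight P φ * idemLeft P γ = 0 := by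
  rw [idemLeft, idemRight, conj_mul_conj, Matrix.mul_fin_two]
  simp [matrix_zero]

theorem idemLeft_mul_nilp (γ : ℂ) : idemLeft P γ * nilp P = nilp P := by
  rw [idemLeft, nilp, conj_mul_conj, Matrix.mul_fin_two]
  simp

theorem nilp_mul_idemRight (φ : ℂ) : nilp P * idemRight P φ = nilp P := by
  rw [idemRight, nilp, conj_mul_conj, Matrix.mul_fin_two]
  simp

theorem nilp_mul_idemLeft (γ : ℂ) : nilp P * idemLeft P γ = 0 := by
  rw [idemLeft, nilp, conj_mul_conj, Matrix.mul_fin_two]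
  simp [matrix_zero]

theorem idemRight_mul_nilp (φ : ℂ) : idemRight P φ * nilp P = 0 := by
  rw [idemRight, nilp, conj_mul_conj, Matrix.mul_fin_two]
  simp [matrix_zero]

theorem nilp_mul_nilp : nilp P * nilp P = 0 := by
  rw [nilp, conj_mul_conj, Matrix.mul_fin_two]
  simp [matrix_zero]

/-- Exhibits these idempotents as an affine line of matrices, so that their slopes in an
`∞`-definable set are finite or cosmall. -/
theorem idemLeft_eq_add (γ : ℂ) : idemLeft P γ = idemLeft P 0 + γ • -nilp P := by
  rw [idemLeft, idemLeft, nilp, smul_neg, ← smul_mul_assoc, ← mul_smul_comm, ← sub_eq_add_neg,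
    ← sub_mul, ← mul_sub]
  congr 2
  ext i j
  fin_cases i <;> fin_cases j <;> simp

theorem idemRight_eq_add (φ : ℂ) : idemRight P φ = idemRight P 0 + φ • nilp P := by
  rw [idemRight, idemRight, nilp, ← smul_mul_assoc, ← mul_smul_comm, ← add_mul, ← mul_add]
  congr 2
  ext i j
  fin_cases i <;> fin_cases j <;> simp

/-- The entries of a matrix in the frame `P`. -/
def entry (i j : Fin 2) : M2 →ₗ[ℂ] ℂ where
  toFun x := (P.inv * x * P.val) i j
  map_add' x y := by simp [mul_add, add_mul]
  map_smul' c x := by simp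

theorem eq_conj (x : M2) :
    x = P.val * !![entry P 0 0 x, entry P 0 1 x; entry P 1 0 x, entry P 1 1 x] * P.inv := by
  have : !![entry P 0 0 x, entry P 0 1 x; entry P 1 0 x, entry P 1 1 x] = P.inv * x * P.val :=
    (Matrix.eta_fin_two (P.inv * x * P.val)).symm
  rw [this]
  simp only [mul_assoc, P.val_inv, mul_one]
  rw [← mul_assoc, P.val_inv, one_mul]

theorem entry_conj (i j : Fin 2) (y : M2) : entry P i j (P.val * y * P.inv) = y i j := by
  simp only [entry, LinearMap.coe_mk, AddHom.coe_mk, mul_assoc, P.inv_val, mul_one]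
  rw [← mul_assoc, P.inv_val, one_mul]

theorem entry_idemLeft (i j : Fin 2) (γ : ℂ) :
    entry P i j (idemLeft P γ) = !![1, -γ; 0, 0] i j := entry_conj ..

theorem entry_idemRight (i j : Fin 2) (φ : ℂ) :
    entry P i j (idemRight P φ) = !![0, φ; 0, 1] i j := entry_conj ..

theorem entry_nilp (i j : Fin 2) : entry P i j (nilp P) = !![0, 1; 0, 0] i j := entry_conj ..

variable {P} in
theorem ext_entry {x y : M2} (h : ∀ i j, entry P i j x = entry P i j y) : x = y := by
  rw [eq_conj P x, eq_conj P y]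
  simp only [h]

/-- The singular matrices that are upper triangular in the frame `P`, with scalar parts in the
given sets. -/
def triangular (A B : Subgroup ℂˣ) (G F C : Set ℂ) : Set M2 :=
  {x | (∃ a ∈ A, ∃ γ ∈ G, x = (a : ℂ) • idemLeft P γ) ∨
    (∃ b ∈ B, ∃ φ ∈ F, x = (b : ℂ) • idemRight P φ) ∨ ∃ c ∈ C, x = c • nilp P}

variable {A B : Subgroup ℂˣ} {G F C : Set ℂ}

/-- The diagonal entries tell the three kinds of matrices apart, and the top row recovers scalar and
slope. The zero matrix is counted among the nilpotents, hence `0 ∈ C`. -/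
theorem smul_idemLeft_mem_triangular (hC : 0 ∈ C) {a : ℂ} {γ : ℂ} :
    a • idemLeft P γ ∈ triangular P A B G F C ↔ a = 0 ∨ (∃ a' ∈ A, a = (a' : ℂ)) ∧ γ ∈ G := by
  constructor
  · rintro (⟨a', ha, γ', hγ, h⟩ | ⟨b, hb, φ, hφ, h⟩ | ⟨c, hc, h⟩)
    · have h0 := congrArg (entry P 0 0) h
      have h1 := congrArg (entry P 0 1) h
      simp [entry_idemLeft] at h0 h1
      subst h0
      simp at h1
      exact .inr ⟨⟨a', ha, rfl⟩, h1 ▸ hγ⟩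
    · have h0 := congrArg (entry P 0 0) h
      simp [entry_idemLeft, entry_idemRight] at h0
      exact .inl h0
    · have h0 := congrArg (entry P 0 0) h
      simp [entry_idemLeft, entry_nilp] at h0
      exact .inl h0
  · rintro (rfl | ⟨⟨a', ha, rfl⟩, hγ⟩)
    · exact .inr (.inr ⟨0, hC, by simp⟩)
    · exact .inl ⟨a', ha, γ, hγ, rfl⟩

theorem smul_idemRight_mem_triangular (hC : 0 ∈ C) {b : ℂ} {φ : ℂ} :
    b • idemRight P φ ∈ triangular P A B G F C ↔ b = 0 ∨ (∃ b' ∈ B, b = (b' : ℂ)) ∧ φ ∈ F := by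
  constructor
  · rintro (⟨a', ha, γ', hγ, h⟩ | ⟨b, hb, φ, hφ, h⟩ | ⟨c, hc, h⟩)
    · have h0 := congrArg (entry P 1 1) h
      simp [entry_idemLeft, entry_idemRight] at h0
      exact .inl h0
    · have h0 := congrArg (entry P 1 1) h
      have h1 := congrArg (entry P 0 1) h
      simp [entry_idemRight] at h0 h1
      subst h0
      simp at h1
      exact .inr ⟨⟨b, hb, rfl⟩, h1 ▸ hφ⟩
    · have h0 := congrArg (entry P 1 1) h
      simp [entry_idemRight, entry_nilp] at h0
      exact .inl h0
  · rintro (rfl | ⟨⟨b', hb, rfl⟩, hφ⟩)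
    · exact .inr (.inr ⟨0, hC, by simp⟩)
    · exact .inr (.inl ⟨b', hb, φ, hφ, rfl⟩)

theorem smul_nilp_mem_triangular {c : ℂ} :
    c • nilp P ∈ triangular P A B G F C ↔ c ∈ C := by
  constructor
  · rintro (⟨a', ha, γ', hγ, h⟩ | ⟨b, hb, φ, hφ, h⟩ | ⟨c, hc, h⟩)
    · have h0 := congrArg (entry P 0 0) h
      simp [entry_idemLeft, entry_nilp] at h0
      exact absurd h0.symm a'.ne_zero
    · have h0 := congrArg (entry P 1 1) h
      simp [entry_idemRight, entry_nilp] at h0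
      exact absurd h0.symm b.ne_zero
    · have h0 := congrArg (entry P 0 1) h
      simp [entry_nilp] at h0
      exact h0 ▸ hc
  · exact fun h ↦ .inr (.inr ⟨c, h, rfl⟩)

/-- The triangular semigroup. -/
def triangularSemigroup (A B : Subgroup ℂˣ) (G F C : Set ℂ) (hC : 0 ∈ C)
    (hA : ∀ a ∈ A, ∀ c ∈ C, (a : ℂ) * c ∈ C) (hB : ∀ b ∈ B, ∀ c ∈ C, (b : ℂ) * c ∈ C)
    (hGF : ∀ γ ∈ G, ∀ φ ∈ F, φ - γ ∈ C) : Subsemigroup M2 where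
  carrier := triangular P A B G F C
  mul_mem' := by
    have h0 : (0 : M2) ∈ triangular P A B G F C := .inr (.inr ⟨0, hC, by simp⟩)
    rintro _ _ (⟨a, ha, γ, hγ, rfl⟩ | ⟨b, hb, φ, hφ, rfl⟩ | ⟨c, hc, rfl⟩)
      (⟨a', ha', γ', hγ', rfl⟩ | ⟨b', hb', φ', hφ', rfl⟩ | ⟨c', hc', rfl⟩) <;>
      simp only [smul_mul_smul_comm, idemLeft_mul_idemLeft, idemLeft_mul_idemRight,
        idemLeft_mul_nilp, idemRight_mul_idemLeft, idemRight_mul_idemRight, idemRight_mul_nilp,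
        nilp_mul_idemLeft, nilp_mul_idemRight, nilp_mul_nilp, smul_zero, h0]
    · exact .inl ⟨a * a', mul_mem ha ha', γ', hγ', by simp⟩
    · rw [smul_smul, smul_nilp_mem_triangular, mul_assoc]
      exact hA a ha _ (hB b' hb' _ (hGF γ hγ φ' hφ'))
    · rw [smul_nilp_mem_triangular]
      exact hA a ha _ hc'
    · exact .inr (.inl ⟨b * b', mul_mem hb hb', φ, hφ, by simp⟩)
    · rw [smul_nilp_mem_triangular, mul_comm]
      exact hB b' hb' _ hc

theorem triangular_subset : triangular P A B G F C ⊆ M20 := by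
  rintro _ (⟨a, ha, γ, hγ, rfl⟩ | ⟨b, hb, φ, hφ, rfl⟩ | ⟨c, hc, rfl⟩) <;>
    change Matrix.det _ = 0 <;>
    simp [idemLeft, idemRight, nilp]

theorem isDefinable_mem (l : M2 →ₗ[ℂ] ℂ) {X : Set ℂ} (hX : X.IsFiniteOrCofinite) :
    IsDefinable {x | l x ∈ X} := by
  have key {X : Set ℂ} (hX : X.Finite) : IsDefinable {x | l x ∈ X} := by
    convert isDefinable_biUnion hX fun c _ ↦ isDefinable_fiber l c using 1
    ext x
    simp
  rcases hX with hX | hX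
  · exact key hX
  · convert (key hX).compl using 1
    ext x
    simp

/-- The matrices off the kernel of `l` at which the ratio of `m` to `l` lies in a finite or cofinite
set. -/
theorem isDefinable_slope (l m : M2 →ₗ[ℂ] ℂ) {X : Set ℂ} (hX : X.IsFiniteOrCofinite) :
    IsDefinable {x | l x ≠ 0 ∧ ∃ c ∈ X, m x = c * l x} := by
  have key {X : Set ℂ} (hX : X.Finite) : IsDefinable {x | ∃ c ∈ X, m x = c * l x} := by
    convert isDefinable_biUnion hX fun c _ ↦ isDefinable_fiber (m - c • l) 0 using 1
    ext x
    simp [sub_eq_zero]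
  rcases hX with hX | hX
  · exact (isDefinable_fiber l 0).compl.inter (key hX)
  -- Off the kernel the ratio exists and is unique, so it lies in the cofinite set exactly when it
  -- is not in the finite complement.
  · convert (isDefinable_fiber l 0).compl.inter (key hX).compl using 1
    ext x
    simp only [Set.mem_ofPred_eq, Set.mem_inter_iff, Set.mem_compl_iff, not_exists, not_and]
    refine and_congr_right fun hx ↦ ⟨?_, fun h ↦ ⟨m x / l x, ?_, by field_simp⟩⟩
    · rintro ⟨c, hc, h⟩ c' hc' h'
      exact hc' (mul_right_cancel₀ hx (h.symm.trans h') ▸ hc)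
    · by_contra hc
      exact h _ hc (by field_simp)

theorem isFiniteOrCofinite_units_image (hA : (A : Set ℂˣ).Finite ∨ A = ⊤) :
    {z : ℂ | ∃ a ∈ A, z = (a : ℂ)}.IsFiniteOrCofinite := by
  refine hA.imp (fun h ↦ ?_) fun h ↦ ?_
  · convert h.image ((↑) : ℂˣ → ℂ) using 1
    ext z
    simp [eq_comm]
  · refine (Set.finite_singleton (0 : ℂ)).subset fun z hz ↦ ?_
    by_contra h0
    exact hz ⟨Units.mk0 z h0, by simp [h], rfl⟩

theorem isDefinable_triangular (hA : (A : Set ℂˣ).Finite ∨ A = ⊤)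
    (hB : (B : Set ℂˣ).Finite ∨ B = ⊤) (hG : G.IsFiniteOrCofinite) (hF : F.IsFiniteOrCofinite)
    (hC : C.IsFiniteOrCofinite) : IsDefinable (triangular P A B G F C) := by
  have h1 := (((isDefinable_slope (entry P 0 0) (-entry P 0 1) hG).inter
    (isDefinable_mem (entry P 0 0) (isFiniteOrCofinite_units_image hA))).inter
    (isDefinable_fiber (entry P 1 0) 0)).inter (isDefinable_fiber (entry P 1 1) 0)
  have h2 := (((isDefinable_slope (entry P 1 1) (entry P 0 1) hF).inter
    (isDefinable_mem (entry P 1 1) (isFiniteOrCofinite_units_image hB))).inter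
    (isDefinable_fiber (entry P 1 0) 0)).inter (isDefinable_fiber (entry P 0 0) 0)
  have h3 := (((isDefinable_mem (entry P 0 1) hC).inter (isDefinable_fiber (entry P 0 0) 0)).inter
    (isDefinable_fiber (entry P 1 0) 0)).inter (isDefinable_fiber (entry P 1 1) 0)
  convert h1.union (h2.union h3) using 1
  ext x
  constructor
  · rintro (⟨a, ha, γ, hγ, rfl⟩ | ⟨b, hb, φ, hφ, rfl⟩ | ⟨c, hc, rfl⟩)
    · left
      simpa [entry_idemLeft] using ⟨⟨γ, hγ, mul_comm _ _⟩, a, ha, rfl⟩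
    · right; left
      simpa [entry_idemRight] using ⟨⟨φ, hφ, mul_comm _ _⟩, b, hb, rfl⟩
    · right; right
      simpa [entry_nilp] using hc
  · rintro (⟨⟨⟨⟨-, γ, hγ, h01⟩, a, ha, h00⟩, h10⟩, h11⟩ |
      ⟨⟨⟨⟨-, φ, hφ, h01⟩, b, hb, h11⟩, h10⟩, h00⟩ | ⟨⟨⟨h01, h00⟩, h10⟩, h11⟩)
    · refine .inl ⟨a, ha, γ, hγ, ext_entry (P := P) ?_⟩
      simp only [Set.mem_ofPred_eq, LinearMap.neg_apply, neg_eq_iff_eq_neg] at h01 h10 h11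
      simp [Fin.forall_fin_two, entry_idemLeft, h00, h01, h10, h11, mul_comm]
    · refine .inr (.inl ⟨b, hb, φ, hφ, ext_entry (P := P) ?_⟩)
      simp only [Set.mem_ofPred_eq] at h01 h10 h00
      simp [Fin.forall_fin_two, entry_idemRight, h00, h01, h10, h11, mul_comm]
    · refine .inr (.inr ⟨_, h01, ext_entry (P := P) ?_⟩)
      simp only [Set.mem_ofPred_eq] at h11 h10 h00
      simp [Fin.forall_fin_two, entry_nilp, h00, h10, h11]

end TwoByTwo

/-! ### Approximation by definable triangular semigroups -/

namespace TwoByTwo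

open Cardinal

variable {A B : Subgroup ℂˣ} {G F C : Set ℂ}

/-- If one of `F`, `G` is finite, keep it and give the other all the slopes it allows: a finite
intersection of translates or reflections of `C`. If both are cosmall, their differences fill ℂ, so
`C` is everything and imposes nothing. -/
theorem exists_isFiniteOrCofinite_sub_mem (hG : IsFiniteOrCosmall G) (hF : IsFiniteOrCosmall F)
    (hC : C.IsFiniteOrCofinite) (hGF : ∀ γ ∈ G, ∀ φ ∈ F, φ - γ ∈ C) :
    ∃ G' F' : Set ℂ, G ⊆ G' ∧ F ⊆ F' ∧ G'.IsFiniteOrCofinite ∧ F'.IsFiniteOrCofinite ∧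
      ∀ γ ∈ G', ∀ φ ∈ F', φ - γ ∈ C := by
  rcases hF with hF | hF
  · refine ⟨⋂ φ ∈ F, (φ - ·) ⁻¹' C, F, ?_, subset_rfl, ?_, .inl hF, ?_⟩
    · exact fun γ hγ ↦ Set.mem_iInter₂.2 fun φ hφ ↦ hGF γ hγ φ hφ
    · exact .biInter hF fun φ _ ↦ hC.preimage sub_right_injective
    · exact fun γ hγ φ hφ ↦ Set.mem_iInter₂.1 hγ φ hφ
  rcases hG with hG | hG
  · refine ⟨G, ⋂ γ ∈ G, (· - γ) ⁻¹' C, subset_rfl, ?_, .inl hG, ?_, ?_⟩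
    · exact fun φ hφ ↦ Set.mem_iInter₂.2 fun γ hγ ↦ hGF γ hγ φ hφ
    · exact .biInter hG fun γ _ ↦ hC.preimage sub_left_injective
    · exact fun γ hγ φ hφ ↦ Set.mem_iInter₂.1 hφ γ hγ
  · refine ⟨Set.univ, Set.univ, Set.subset_univ _, Set.subset_univ _, .univ, .univ,
      fun γ _ φ _ ↦ ?_⟩
    obtain ⟨φ', hφ', hγ'⟩ := IsFiniteOrCosmall.exists_mem_sub_mem hF hG (φ - γ)
    simpa using hGF _ hγ' _ hφ'

/-- The orbit of `c` under both groups is finite if both are finite, and is ℂ^× otherwise. -/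
theorem isFiniteOrCofinite_compl_orbit (hA : (A : Set ℂˣ).Finite ∨ A = ⊤)
    (hB : (B : Set ℂˣ).Finite ∨ B = ⊤) {c : ℂ} (hc : c ≠ 0) :
    {z : ℂ | ∀ a ∈ A, ∀ b ∈ B, z ≠ a * b * c}.IsFiniteOrCofinite := by
  have key (h : ∀ z : ℂˣ, ∃ a ∈ A, ∃ b ∈ B, z = a * b) :
      {z : ℂ | ∀ a ∈ A, ∀ b ∈ B, z ≠ a * b * c}.IsFiniteOrCofinite := by
    refine .inl ((Set.finite_singleton 0).subset fun z hz ↦ ?_)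
    by_contra hz0
    obtain ⟨a, ha, b, hb, h⟩ := h (Units.mk0 (z / c) (div_ne_zero hz0 hc))
    refine hz a ha b hb ?_
    rw [← Units.val_mul, ← h, Units.val_mk0]
    field_simp
  rcases hA with hA | rfl
  · rcases hB with hB | rfl
    · refine .inr ((hA.image2 (fun a b : ℂˣ ↦ (a * b * c : ℂ)) hB).subset fun z hz ↦ ?_)
      simp only [Set.mem_compl_iff, Set.mem_ofPred_eq, not_forall, not_not] at hz
      obtain ⟨a, ha, b, hb, rfl⟩ := hz
      exact ⟨a, ha, b, hb, rfl⟩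
    · exact key fun z ↦ ⟨1, one_mem _, z, trivial, by simp⟩
  · exact key fun z ↦ ⟨z, trivial, 1, one_mem _, by simp⟩

variable (P : M2ˣ)

/-- A triangular semigroup with finite or cosmall parts is the intersection of a small family of
definable semigroups. -/
theorem exists_family_triangular (hA : (A : Set ℂˣ).Finite ∨ A = ⊤)
    (hB : (B : Set ℂˣ).Finite ∨ B = ⊤) (hG : IsFiniteOrCosmall G) (hF : IsFiniteOrCosmall F)
    (hC : IsFiniteOrCosmall C) (h0 : 0 ∈ C) (hAC : ∀ a ∈ A, ∀ c ∈ C, (a : ℂ) * c ∈ C)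
    (hBC : ∀ b ∈ B, ∀ c ∈ C, (b : ℂ) * c ∈ C) (hGF : ∀ γ ∈ G, ∀ φ ∈ F, φ - γ ∈ C) :
    ∃ (κ : Type) (T : κ → Subsemigroup M2), #κ < 𝔠 ∧
      (∀ i, T i ≤ M20 ∧ IsDefinable (T i : Set M2)) ∧
      triangular P A B G F C = ⋂ i, (T i : Set M2) := by
  have hone (X : Set ℂ) (hX : IsFiniteOrCosmall X) := hX.exists_family Set.IsFiniteOrCofinite .univ
    .inl fun x hx ↦ ⟨{x}ᶜ, .inr (by simp), by simpa using hx, by simp⟩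
  obtain ⟨κG, YG, hκG, hnG, hYG, rfl⟩ := hone G hG
  obtain ⟨κF, YF, hκF, -, hYF, rfl⟩ := hone F hF
  -- Slopes may be removed one at a time, but the sets around `C` must stay stable under `A` and
  -- `B`: for `x` outside `C` the whole orbit is removed, which `C` misses by its own stability.
  obtain ⟨κC, YC, hκC, -, hYC, hCY⟩ := hC.exists_family
    (fun Y ↦ Y.IsFiniteOrCofinite ∧ 0 ∈ Y ∧ (∀ a ∈ A, ∀ c ∈ Y, (a : ℂ) * c ∈ Y) ∧
      ∀ b ∈ B, ∀ c ∈ Y, (b : ℂ) * c ∈ Y)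
    ⟨.univ, trivial, fun _ _ _ _ ↦ trivial, fun _ _ _ _ ↦ trivial⟩
    (fun h ↦ ⟨.inl h, h0, hAC, hBC⟩) fun x hx ↦ by
      have hx0 : x ≠ 0 := fun h ↦ hx (h ▸ h0)
      refine ⟨_, ⟨isFiniteOrCofinite_compl_orbit hA hB hx0, ?_, ?_, ?_⟩, ?_, ?_⟩
      · exact fun a _ b _ ↦ by simp [hx0]
      · intro a ha c hc a' ha' b' hb' h
        refine hc (a⁻¹ * a') (mul_mem (inv_mem ha) ha') b' hb' ?_
        rw [Units.val_mul, mul_assoc, mul_assoc, ← mul_assoc (a' : ℂ), ← h]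
        simp
      · intro b hb c hc a' ha' b' hb' h
        refine hc a' ha' (b⁻¹ * b') (mul_mem (inv_mem hb) hb') ?_
        have : (b : ℂ)⁻¹ * (b * c) = (b : ℂ)⁻¹ * (a' * b' * x) := by rw [h]
        rw [inv_mul_cancel_left₀ b.ne_zero] at this
        rw [this, Units.val_mul, Units.val_inv_eq_inv_val]
        ring
      · intro c hc a ha b hb h
        have := hBC _ (inv_mem hb) _ (hAC _ (inv_mem ha) _ hc)
        subst h
        refine hx ?_
        convert this using 1
        push_cast
        field_simp
      · exact fun h ↦ h 1 (one_mem _) 1 (one_mem _) (by simp)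
  have hGF' (i) : ∀ γ ∈ ⋂ i, YG i, ∀ φ ∈ ⋂ i, YF i, φ - γ ∈ YC i := fun γ hγ φ hφ ↦
    Set.mem_iInter.1 (hCY ▸ hGF γ hγ φ hφ) i
  choose G' F' hG' hF' hG'f hF'f hGFC using fun i ↦
    exists_isFiniteOrCofinite_sub_mem hG hF (hYC i).1 (hGF' i)
  -- The first two families pin down the slopes, with all nilpotents allowed; the third pins down
  -- the nilpotents, with slopes enlarged just enough to stay a semigroup.
  let T : κG ⊕ κF ⊕ κC → Subsemigroup M2 := Sum.elim
    (fun i ↦ triangularSemigroup P A B (YG i) Set.univ Set.univ trivial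
      (fun _ _ _ _ ↦ trivial) (fun _ _ _ _ ↦ trivial) fun _ _ _ _ ↦ trivial) <| Sum.elim
    (fun i ↦ triangularSemigroup P A B Set.univ (YF i) Set.univ trivial
      (fun _ _ _ _ ↦ trivial) (fun _ _ _ _ ↦ trivial) fun _ _ _ _ ↦ trivial)
    (fun i ↦ triangularSemigroup P A B (G' i) (F' i) (YC i) (hYC i).2.1 (hYC i).2.2.1
      (hYC i).2.2.2 (hGFC i))
  refine ⟨_, T, ?_, ?_, ?_⟩
  · simp only [mk_sum, lift_id]
    exact add_lt_of_lt aleph0_le_continuum hκG (add_lt_of_lt aleph0_le_continuum hκF hκC)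
  · rintro (i | i | i) <;> refine ⟨triangular_subset P, isDefinable_triangular P hA hB ?_ ?_ ?_⟩
    exacts [hYG i, .univ, .univ, .univ, hYF i, .univ, hG'f i, hF'f i, (hYC i).1]
  · refine Set.Subset.antisymm (Set.subset_iInter fun i ↦ ?_) fun x hx ↦ ?_
    · have mono {G₁ F₁ C₁ : Set ℂ} (h₁ : (⋂ i, YG i) ⊆ G₁) (h₂ : (⋂ i, YF i) ⊆ F₁) (h₃ : C ⊆ C₁) :
          triangular P A B (⋂ i, YG i) (⋂ i, YF i) C ⊆ triangular P A B G₁ F₁ C₁ := by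
        rintro _ (⟨a, ha, γ, hγ, rfl⟩ | ⟨b, hb, φ, hφ, rfl⟩ | ⟨c, hc, rfl⟩)
        exacts [.inl ⟨a, ha, γ, h₁ hγ, rfl⟩, .inr (.inl ⟨b, hb, φ, h₂ hφ, rfl⟩),
          .inr (.inr ⟨c, h₃ hc, rfl⟩)]
      rcases i with i | i | i
      · exact mono (Set.iInter_subset _ i) (Set.subset_univ _) (Set.subset_univ _)
      · exact mono (Set.subset_univ _) (Set.iInter_subset _ i) (Set.subset_univ _)
      · exact mono (hG' i) (hF' i) (hCY ▸ Set.iInter_subset _ i)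
    · rw [Set.mem_iInter] at hx
      have hxG (i) : x ∈ triangular P A B (YG i) Set.univ Set.univ := hx (.inl i)
      have hxF (i) : x ∈ triangular P A B Set.univ (YF i) Set.univ := hx (.inr (.inl i))
      have hxC (i) : x ∈ triangular P A B (G' i) (F' i) (YC i) := hx (.inr (.inr i))
      -- Some index is needed to know that `x` is triangular at all.
      obtain ⟨i₀⟩ := hnG
      rcases hxG i₀ with ⟨a, ha, γ, -, rfl⟩ | ⟨b, hb, φ, -, rfl⟩ | ⟨c, -, rfl⟩
      · simp only [smul_idemLeft_mem_triangular P (Set.mem_univ 0), Units.ne_zero, false_or] at hxG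
        exact .inl ⟨a, ha, γ, Set.mem_iInter.2 fun i ↦ (hxG i).2, rfl⟩
      · simp only [smul_idemRight_mem_triangular P (Set.mem_univ 0), Units.ne_zero, false_or]
          at hxF
        exact .inr (.inl ⟨b, hb, φ, Set.mem_iInter.2 fun i ↦ (hxF i).2, rfl⟩)
      · simp only [smul_nilp_mem_triangular] at hxC
        exact .inr (.inr ⟨c, hCY ▸ Set.mem_iInter.2 hxC, rfl⟩)

end TwoByTwo

/-! ### Images and kernels in a frame -/

namespace TwoByTwo

theorem mulVec_ne_zero (P : M2ˣ) {w : Fin 2 → ℂ} (hw : w ≠ 0) : P.val.mulVec w ≠ 0 := fun h ↦ by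
  have := congrArg P.inv.mulVec h
  rw [Matrix.mulVec_mulVec, P.inv_val, Matrix.one_mulVec, Matrix.mulVec_zero] at this
  exact hw this

/-- The first basis line of the frame `P`. -/
noncomputable def basePoint (P : M2ˣ) : P1 :=
  Projectivization.mk ℂ (P.val.mulVec ![1, 0]) (mulVec_ne_zero P (by simp))

/-- The line of slope `γ` in the frame `P`. -/
noncomputable def affinePoint (P : M2ˣ) (γ : ℂ) : P1 :=
  Projectivization.mk ℂ (P.val.mulVec ![γ, 1]) (mulVec_ne_zero P (by simp))

theorem exists_basePoint_eq (v : P1) : ∃ P : M2ˣ, basePoint P = v := by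
  induction v using Projectivization.ind with | h w hw => ?_
  obtain ⟨M, hM, h⟩ : ∃ M : M2, M.det ≠ 0 ∧ M.mulVec ![1, 0] = w := by
    by_cases h0 : w 0 = 0
    · refine ⟨!![w 0, 1; w 1, 0], ?_, ?_⟩
      · have h1 : w 1 ≠ 0 := fun h1 ↦ hw (by ext i; fin_cases i <;> simp [h0, h1])
        simp [Matrix.det_fin_two, h1]
      · ext i; fin_cases i <;> simp
    · refine ⟨!![w 0, 0; w 1, 1], ?_, ?_⟩
      · simp [Matrix.det_fin_two, h0]
      · ext i; fin_cases i <;> simp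
  refine ⟨Matrix.nonsingInvUnit M (isUnit_iff_ne_zero.2 hM), ?_⟩
  subst h
  rfl

theorem HasImageKernel.unique {x : M2} {v u v' u' : P1} (h : HasImageKernel x v u)
    (h' : HasImageKernel x v' u') : v = v' ∧ u = u' :=
  ⟨Projectivization.submodule_injective (h.1.symm.trans h'.1),
    Projectivization.submodule_injective (h.2.symm.trans h'.2)⟩

theorem HasImageKernel.smul {x : M2} {v u : P1} (h : HasImageKernel x v u) {c : ℂ} (hc : c ≠ 0) :
    HasImageKernel (c • x) v u := by
  unfold HasImageKernel at *
  rw [map_smul, LinearMap.range_smul _ _ hc, LinearMap.ker_smul _ _ hc]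
  exact h

theorem HasImageKernel.ne_zero {x : M2} {v u : P1} (h : HasImageKernel x v u) : x ≠ 0 := by
  rintro rfl
  have h1 := h.1
  induction v using Projectivization.ind with | h w hw => ?_
  simp at h1
  exact hw (Submodule.span_singleton_eq_bot.1 h1.symm)

theorem proj_eq_proj {x y : M2} : proj x = proj y ↔ ∃ c : ℂ, c ≠ 0 ∧ c • y = x := by
  rw [proj, proj, Quotient.eq, MulAction.orbitRel_apply, MulAction.mem_orbit_iff]
  constructor
  · rintro ⟨c, h⟩
    exact ⟨c, c.ne_zero, h⟩
  · rintro ⟨c, hc, h⟩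
    exact ⟨Units.mk0 c hc, h⟩

theorem proj_mem_B {x : M2} {F G : Set P1} :
    proj x ∈ B F G ↔ x = 0 ∨ ∃ v ∈ F, ∃ u ∈ G, HasImageKernel x v u := by
  constructor
  · rintro (h | ⟨y, v, hv, u, hu, h, hxy⟩)
    · obtain ⟨c, hc, h⟩ := proj_eq_proj.1 h
      exact .inl (by simp [← h])
    · obtain ⟨c, hc, rfl⟩ := proj_eq_proj.1 hxy
      exact .inr ⟨v, hv, u, hu, h.smul hc⟩
  · rintro (rfl | ⟨v, hv, u, hu, h⟩)
    · exact .inl rfl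
    · exact .inr ⟨x, v, hv, u, hu, h, rfl⟩

variable (P : M2ˣ)

theorem hasImageKernel_conj {y : M2} {a b : Fin 2 → ℂ} (ha : P.val.mulVec a ≠ 0)
    (hb : P.val.mulVec b ≠ 0) (h1 : ∀ z, (∃ t, y.mulVec t = z) ↔ ∃ c : ℂ, c • a = z)
    (h2 : ∀ z, y.mulVec z = 0 ↔ ∃ c : ℂ, c • b = z) :
    HasImageKernel (P.val * y * P.inv) (Projectivization.mk ℂ (P.val.mulVec a) ha)
      (Projectivization.mk ℂ (P.val.mulVec b) hb) := by
  have hP (z : Fin 2 → ℂ) : P.val.mulVec (P.inv.mulVec z) = z := by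
    rw [Matrix.mulVec_mulVec, P.val_inv, Matrix.one_mulVec]
  have hP' (z : Fin 2 → ℂ) : P.inv.mulVec (P.val.mulVec z) = z := by
    rw [Matrix.mulVec_mulVec, P.inv_val, Matrix.one_mulVec]
  have hinj {z t : Fin 2 → ℂ} (h : P.val.mulVec z = P.val.mulVec t) : z = t := by
    rw [← hP' z, h, hP']
  constructor
  · ext z
    rw [Projectivization.submodule_mk, Submodule.mem_span_singleton, LinearMap.mem_range]
    obtain ⟨z, rfl⟩ : ∃ z', P.val.mulVec z' = z := ⟨_, hP z⟩
    simp only [Matrix.toLin'_apply, ← Matrix.mulVec_smul, ← Matrix.mulVec_mulVec]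
    constructor
    · rintro ⟨t, ht⟩
      obtain ⟨c, hc⟩ := (h1 z).1 ⟨_, hinj ht⟩
      exact ⟨c, by rw [hc]⟩
    · rintro ⟨c, hc⟩
      obtain ⟨t, ht⟩ := (h1 z).2 ⟨c, hinj hc⟩
      exact ⟨P.val.mulVec t, by rw [hP', ht]⟩
  · ext z
    rw [Projectivization.submodule_mk, Submodule.mem_span_singleton, LinearMap.mem_ker]
    obtain ⟨z, rfl⟩ : ∃ z', P.val.mulVec z' = z := ⟨_, hP z⟩
    simp only [Matrix.toLin'_apply, ← Matrix.mulVec_smul, ← Matrix.mulVec_mulVec, hP']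
    constructor
    · intro h
      obtain ⟨c, hc⟩ := (h2 z).1 (hinj (h.trans (Matrix.mulVec_zero _).symm))
      exact ⟨c, by rw [hc]⟩
    · rintro ⟨c, hc⟩
      rw [(h2 z).2 ⟨c, hinj hc⟩, Matrix.mulVec_zero]

theorem hasImageKernel_idemLeft (γ : ℂ) :
    HasImageKernel (idemLeft P γ) (basePoint P) (affinePoint P γ) := by
  refine hasImageKernel_conj P _ _ (fun z ↦ ?_) fun z ↦ ?_
  · constructor
    · rintro ⟨t, rfl⟩
      refine ⟨t 0 - γ * t 1, ?_⟩
      ext i; fin_cases i <;> simp [Matrix.mulVec, dotProduct, Fin.sum_univ_two, sub_eq_add_neg]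
    · rintro ⟨c, rfl⟩
      refine ⟨![c, 0], ?_⟩
      ext i; fin_cases i <;> simp [Matrix.mulVec, dotProduct, Fin.sum_univ_two]
  · constructor
    · intro h
      have h0 := congrFun h 0
      simp [Matrix.mulVec, dotProduct, Fin.sum_univ_two] at h0
      refine ⟨z 1, ?_⟩
      ext i; fin_cases i <;> simp
      linear_combination -h0
    · rintro ⟨c, rfl⟩
      ext i; fin_cases i <;> simp [Matrix.mulVec, dotProduct, Fin.sum_univ_two, mul_comm]

theorem hasImageKernel_idemRight (φ : ℂ) :
    HasImageKernel (idemRight P φ) (affinePoint P φ) (basePoint P) := by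
  refine hasImageKernel_conj P _ _ (fun z ↦ ?_) fun z ↦ ?_
  · constructor
    · rintro ⟨t, rfl⟩
      refine ⟨t 1, ?_⟩
      ext i; fin_cases i <;> simp [Matrix.mulVec, dotProduct, Fin.sum_univ_two, mul_comm]
    · rintro ⟨c, rfl⟩
      refine ⟨![0, c], ?_⟩
      ext i; fin_cases i <;> simp [Matrix.mulVec, dotProduct, Fin.sum_univ_two, mul_comm]
  · constructor
    · intro h
      have h1 := congrFun h 1
      simp [Matrix.mulVec, dotProduct, Fin.sum_univ_two] at h1
      refine ⟨z 0, ?_⟩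
      ext i; fin_cases i <;> simp [h1]
    · rintro ⟨c, rfl⟩
      ext i; fin_cases i <;> simp [Matrix.mulVec, dotProduct, Fin.sum_univ_two]

theorem hasImageKernel_nilp : HasImageKernel (nilp P) (basePoint P) (basePoint P) := by
  refine hasImageKernel_conj P _ _ (fun z ↦ ?_) fun z ↦ ?_
  · constructor
    · rintro ⟨t, rfl⟩
      refine ⟨t 1, ?_⟩
      ext i; fin_cases i <;> simp [Matrix.mulVec, dotProduct, Fin.sum_univ_two]
    · rintro ⟨c, rfl⟩
      refine ⟨![0, c], ?_⟩
      ext i; fin_cases i <;> simp [Matrix.mulVec, dotProduct, Fin.sum_univ_two]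
  · constructor
    · intro h
      have h0 := congrFun h 0
      simp [Matrix.mulVec, dotProduct, Fin.sum_univ_two] at h0
      refine ⟨z 0, ?_⟩
      ext i; fin_cases i <;> simp [h0]
    · rintro ⟨c, rfl⟩
      ext i; fin_cases i <;> simp [Matrix.mulVec, dotProduct, Fin.sum_univ_two]

theorem affinePoint_ne_basePoint (γ : ℂ) : affinePoint P γ ≠ basePoint P := by
  intro h
  obtain ⟨c, hc⟩ := (Projectivization.mk_eq_mk_iff' ..).1 h
  have := congrArg P.inv.mulVec hc
  rw [Matrix.mulVec_smul, Matrix.mulVec_mulVec, Matrix.mulVec_mulVec, P.inv_val,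
    Matrix.one_mulVec, Matrix.one_mulVec] at this
  simpa using congrFun this 1

variable {P}

theorem exists_affinePoint_eq {u : P1} (hu : u ≠ basePoint P) : ∃ γ, affinePoint P γ = u := by
  induction u using Projectivization.ind with | h w hw => ?_
  obtain ⟨z, rfl⟩ : ∃ z, P.val.mulVec z = w :=
    ⟨P.inv.mulVec w, by rw [Matrix.mulVec_mulVec, P.val_inv, Matrix.one_mulVec]⟩
  have hz1 : z 1 ≠ 0 := fun h1 ↦ hu <| by
    refine (Projectivization.mk_eq_mk_iff' ..).2 ⟨z 0, ?_⟩
    rw [← Matrix.mulVec_smul]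
    congr 1
    ext i; fin_cases i <;> simp [h1]
  refine ⟨z 0 / z 1, (Projectivization.mk_eq_mk_iff' ..).2 ⟨(z 1)⁻¹, ?_⟩⟩
  rw [← Matrix.mulVec_smul]
  congr 1
  ext i; fin_cases i <;> simp [hz1, div_eq_inv_mul]

theorem entry_eq_mulVec (x : M2) (i j : Fin 2) :
    entry P i j x = P.inv.mulVec (x.mulVec (P.val.mulVec (Pi.single j 1))) i := by
  rw [Matrix.mulVec_mulVec, Matrix.mulVec_mulVec, Matrix.mulVec_single_one]
  rfl

/-- The second row of `x` in the frame vanishes; the top left entry decides between a multiple of an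
idempotent and a nilpotent. -/
theorem HasImageKernel.eq_of_image {x : M2} {u : P1} (h : HasImageKernel x (basePoint P) u) :
    (∃ a : ℂ, a ≠ 0 ∧ ∃ γ, x = a • idemLeft P γ ∧ u = affinePoint P γ) ∨
      ∃ c : ℂ, c ≠ 0 ∧ x = c • nilp P ∧ u = basePoint P := by
  have h1 (j) : entry P 1 j x = 0 := by
    have hm : x.mulVec (P.val.mulVec (Pi.single j 1)) ∈ (basePoint P).submodule := by
      rw [← h.1]
      exact ⟨_, Matrix.toLin'_apply ..⟩
    rw [basePoint, Projectivization.submodule_mk, Submodule.mem_span_singleton] at hm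
    obtain ⟨c, hc⟩ := hm
    rw [entry_eq_mulVec, ← hc, ← Matrix.mulVec_smul, Matrix.mulVec_mulVec, P.inv_val,
      Matrix.one_mulVec]
    simp
  by_cases h0 : entry P 0 0 x = 0
  · have hx : x = entry P 0 1 x • nilp P := ext_entry (P := P) <| by
      simp [Fin.forall_fin_two, entry_nilp, h0, h1]
    have hc : entry P 0 1 x ≠ 0 := fun hc ↦ h.ne_zero (by rw [hx, hc, zero_smul])
    rw [hx] at h
    exact .inr ⟨_, hc, hx, (h.unique ((hasImageKernel_nilp P).smul hc)).2⟩
  · have hx : x = entry P 0 0 x • idemLeft P (-(entry P 0 1 x / entry P 0 0 x)) :=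
      ext_entry (P := P) <| by
        simp [Fin.forall_fin_two, entry_idemLeft, h1, mul_div_cancel₀ _ h0]
    refine .inl ⟨_, h0, _, hx, ?_⟩
    rw [hx] at h
    exact (h.unique ((hasImageKernel_idemLeft P _).smul h0)).2

theorem HasImageKernel.eq_of_kernel {x : M2} {u : P1} (h : HasImageKernel x u (basePoint P)) :
    (∃ b : ℂ, b ≠ 0 ∧ ∃ φ, x = b • idemRight P φ ∧ u = affinePoint P φ) ∨
      ∃ c : ℂ, c ≠ 0 ∧ x = c • nilp P ∧ u = basePoint P := by
  have h1 (i) : entry P i 0 x = 0 := by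
    have hm : P.val.mulVec (Pi.single 0 1) ∈ (basePoint P).submodule := by
      rw [basePoint, Projectivization.submodule_mk, Submodule.mem_span_singleton]
      refine ⟨1, ?_⟩
      rw [one_smul]
      congr 1
      ext i; fin_cases i <;> rfl
    rw [← h.2, LinearMap.mem_ker, Matrix.toLin'_apply] at hm
    rw [entry_eq_mulVec, hm, Matrix.mulVec_zero, Pi.zero_apply]
  by_cases h0 : entry P 1 1 x = 0
  · have hx : x = entry P 0 1 x • nilp P := ext_entry (P := P) <| by
      simp [Fin.forall_fin_two, entry_nilp, h0, h1]
    have hc : entry P 0 1 x ≠ 0 := fun hc ↦ h.ne_zero (by rw [hx, hc, zero_smul])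
    rw [hx] at h
    exact .inr ⟨_, hc, hx, (h.unique ((hasImageKernel_nilp P).smul hc)).1⟩
  · have hx : x = entry P 1 1 x • idemRight P (entry P 0 1 x / entry P 1 1 x) :=
      ext_entry (P := P) <| by
        simp [Fin.forall_fin_two, entry_idemRight, h1, mul_div_cancel₀ _ h0]
    refine .inl ⟨_, h0, _, hx, ?_⟩
    rw [hx] at h
    exact (h.unique ((hasImageKernel_idemRight P _).smul h0)).1

end TwoByTwo

/-! ### Structure of the semigroup -/

namespace TwoByTwo

variable {S : Subsemigroup M2}

/-- In an `∞`-definable semigroup, the scalars of a family of idempotents that absorb each other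
form a group that does not depend on the idempotent. -/
theorem exists_scalar_subgroup (e : ℂ → M2)
    (he : ∀ γ γ' (a : ℂ), a • e γ ∈ S → e γ' ∈ S → a • e γ' ∈ S)
    (hidem : ∀ γ, e γ * e γ = e γ) (hdef : IsInftyDefinable (S : Set M2)) :
    ∃ A : Subgroup ℂˣ, ((A : Set ℂˣ).Finite ∨ A = ⊤) ∧
      (∀ (a : ℂˣ) γ, (a : ℂ) • e γ ∈ S ↔ a ∈ A ∧ e γ ∈ S) ∧
      ∀ a ∈ A, a = 1 ∨ ∃ γ, (a : ℂ) • e γ ∈ S := by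
  have hmul (γ) : ∀ x ∈ {a : ℂ | a • e γ ∈ S}, ∀ y ∈ {a : ℂ | a • e γ ∈ S},
      x * y ∈ {a : ℂ | a • e γ ∈ S} := fun x hx y hy ↦ by
    have := S.mul_mem hx hy
    rwa [smul_mul_smul_comm, hidem] at this
  have hsmall (γ) : IsFiniteOrCosmall {a : ℂ | a • e γ ∈ S} := by
    simpa using hdef.isFiniteOrCosmall_line 0 (e γ)
  have hone (γ) (a : ℂˣ) (h : (a : ℂ) • e γ ∈ S) : e γ ∈ S := by
    have : (1 : ℂ) • e γ ∈ S := by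
      rcases (hsmall γ).inv_mem_or_forall_mem (hmul γ) with ⟨-, h'⟩ | h'
      · exact (h' a h a.ne_zero).1
      · exact h' 1 one_ne_zero
    rwa [one_smul] at this
  by_cases hex : ∃ γ, e γ ∈ S
  · obtain ⟨γ₀, hγ₀⟩ := hex
    let A : Subgroup ℂˣ :=
      { carrier := {a | (a : ℂ) • e γ₀ ∈ S}
        one_mem' := by simpa using hγ₀
        mul_mem' := fun {a b} ha hb ↦ by simpa using hmul γ₀ a ha b hb
        inv_mem' := fun {a} ha ↦ by
          rcases (hsmall γ₀).inv_mem_or_forall_mem (hmul γ₀) with ⟨-, h'⟩ | h'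
          · simpa using (h' a ha a.ne_zero).2
          · exact h' _ (Units.ne_zero _) }
    refine ⟨A, ?_, fun a γ ↦ ⟨fun h ↦ ⟨he _ _ _ h hγ₀, hone _ _ h⟩, fun h ↦ he _ _ _ h.1 h.2⟩,
      fun a ha ↦ .inr ⟨γ₀, ha⟩⟩
    rcases (hsmall γ₀).inv_mem_or_forall_mem (hmul γ₀) with ⟨hfin, -⟩ | h'
    · exact .inl (Set.Finite.preimage (f := ((↑) : ℂˣ → ℂ)) Units.val_injective.injOn hfin)
    · exact .inr (eq_top_iff.2 fun a _ ↦ h' a a.ne_zero)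
  · push Not at hex
    -- With no idempotent of the family in `S`, no nonzero multiple of one is there either. The
    -- trivial group is a default that keeps the nilpotent scalars stable.
    refine ⟨⊥, .inl (by simp), fun a γ ↦ ⟨fun h ↦ (hex γ (hone γ a h)).elim,
      fun h ↦ (hex γ h.2).elim⟩, fun a ha ↦ .inl (by simpa using ha)⟩

variable {F G : Set P1} {P : M2ˣ}

theorem zero_mem_of_image_proj
    (hB : proj '' (S : Set M2) = B F {basePoint P} ∪ B {basePoint P} G) : (0 : M2) ∈ S := by
  have : proj 0 ∈ proj '' (S : Set M2) := hB ▸ .inl (proj_mem_B.2 (.inl rfl))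
  obtain ⟨x, hx, h⟩ := this
  obtain ⟨c, -, rfl⟩ := proj_eq_proj.1 h
  simpa using hx

theorem exists_smul_mem_of_image_proj
    (hB : proj '' (S : Set M2) = B F {basePoint P} ∪ B {basePoint P} G) {x : M2}
    (hx : proj x ∈ B F {basePoint P} ∪ B {basePoint P} G) : ∃ c : ℂ, c ≠ 0 ∧ c • x ∈ S := by
  rw [← hB] at hx
  obtain ⟨y, hy, h⟩ := hx
  obtain ⟨c, hc, rfl⟩ := proj_eq_proj.1 h
  exact ⟨c, hc, hy⟩

/-- The shape of π(S) only gives a nonzero multiple in `S`; the group of scalars contains 1, which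
brings in the idempotent itself. -/
theorem idemLeft_mem_iff (hdef : IsInftyDefinable (S : Set M2))
    (hB : proj '' (S : Set M2) = B F {basePoint P} ∪ B {basePoint P} G) {γ : ℂ} :
    idemLeft P γ ∈ S ↔ affinePoint P γ ∈ G := by
  have hk := hasImageKernel_idemLeft P γ
  constructor
  · intro h
    rcases hB ▸ Set.mem_image_of_mem proj h with h | h <;> rcases proj_mem_B.1 h with
      h0 | ⟨v, hv, u, hu, h⟩
    · exact (hk.ne_zero h0).elim
    · exact (affinePoint_ne_basePoint P γ ((hk.unique h).2.trans hu)).elim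
    · exact (hk.ne_zero h0).elim
    · exact (hk.unique h).2 ▸ hu
  · intro h
    obtain ⟨c, hc, hcS⟩ := exists_smul_mem_of_image_proj hB
      (.inr (proj_mem_B.2 (.inr ⟨_, rfl, _, h, hk⟩)))
    obtain ⟨A, -, hA, -⟩ := exists_scalar_subgroup (idemLeft P) (fun γ γ' a h h' ↦ by
      simpa [smul_mul_assoc, idemLeft_mul_idemLeft] using S.mul_mem h h')
      (fun γ ↦ idemLeft_mul_idemLeft P γ γ) hdef
    exact ((hA (Units.mk0 c hc) γ).1 hcS).2

theorem idemRight_mem_iff (hdef : IsInftyDefinable (S : Set M2))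
    (hB : proj '' (S : Set M2) = B F {basePoint P} ∪ B {basePoint P} G) {φ : ℂ} :
    idemRight P φ ∈ S ↔ affinePoint P φ ∈ F := by
  have hk := hasImageKernel_idemRight P φ
  constructor
  · intro h
    rcases hB ▸ Set.mem_image_of_mem proj h with h | h <;> rcases proj_mem_B.1 h with
      h0 | ⟨v, hv, u, hu, h⟩
    · exact (hk.ne_zero h0).elim
    · exact (hk.unique h).1 ▸ hv
    · exact (hk.ne_zero h0).elim
    · exact (affinePoint_ne_basePoint P φ ((hk.unique h).1.trans hv)).elim
  · intro h
    obtain ⟨c, hc, hcS⟩ := exists_smul_mem_of_image_proj hB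
      (.inl (proj_mem_B.2 (.inr ⟨_, h, _, rfl, hk⟩)))
    obtain ⟨A, -, hA, -⟩ := exists_scalar_subgroup (idemRight P) (fun γ γ' a h h' ↦ by
      simpa [mul_smul_comm, idemRight_mul_idemRight] using S.mul_mem h' h)
      (fun γ ↦ idemRight_mul_idemRight P γ γ) hdef
    exact ((hA (Units.mk0 c hc) φ).1 hcS).2

/-- Nilpotents square to zero, so their scalars need not form a group and only some multiple is
obtained. -/
theorem exists_smul_nilp_mem_iff
    (hB : proj '' (S : Set M2) = B F {basePoint P} ∪ B {basePoint P} G) :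
    (∃ c : ℂ, c ≠ 0 ∧ c • nilp P ∈ S) ↔ basePoint P ∈ F ∪ G := by
  constructor
  · rintro ⟨c, hc, h⟩
    have hk := (hasImageKernel_nilp P).smul hc
    rcases hB ▸ Set.mem_image_of_mem proj h with h | h <;> rcases proj_mem_B.1 h with
      h0 | ⟨v, hv, u, hu, h⟩
    · exact (hk.ne_zero h0).elim
    · exact .inl ((hk.unique h).1 ▸ hv)
    · exact (hk.ne_zero h0).elim
    · exact .inr ((hk.unique h).2 ▸ hu)
  · intro h
    refine exists_smul_mem_of_image_proj hB (h.imp (fun h ↦ proj_mem_B.2 (.inr ?_)) fun h ↦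
      proj_mem_B.2 (.inr ?_))
    · exact ⟨_, h, _, rfl, hasImageKernel_nilp P⟩
    · exact ⟨_, rfl, _, h, hasImageKernel_nilp P⟩

/-- The semigroup is triangular in the frame `P`. -/
theorem exists_eq_triangular (hdef : IsInftyDefinable (S : Set M2))
    (hB : proj '' (S : Set M2) = B F {basePoint P} ∪ B {basePoint P} G) :
    ∃ (A B : Subgroup ℂˣ), ((A : Set ℂˣ).Finite ∨ A = ⊤) ∧ ((B : Set ℂˣ).Finite ∨ B = ⊤) ∧
      (∀ a ∈ A, ∀ c : ℂ, c • nilp P ∈ S → ((a : ℂ) * c) • nilp P ∈ S) ∧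
      (∀ b ∈ B, ∀ c : ℂ, c • nilp P ∈ S → ((b : ℂ) * c) • nilp P ∈ S) ∧
      (S : Set M2) = triangular P A B {γ | idemLeft P γ ∈ S} {φ | idemRight P φ ∈ S}
        {c | c • nilp P ∈ S} := by
  obtain ⟨A, hA, hAS, hA1⟩ := exists_scalar_subgroup (idemLeft P) (fun γ γ' a h h' ↦ by
      simpa [smul_mul_assoc, idemLeft_mul_idemLeft] using S.mul_mem h h')
      (fun γ ↦ idemLeft_mul_idemLeft P γ γ) hdef
  obtain ⟨B, hB', hBS, hB1⟩ := exists_scalar_subgroup (idemRight P) (fun γ γ' a h h' ↦ by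
      simpa [mul_smul_comm, idemRight_mul_idemRight] using S.mul_mem h' h)
      (fun γ ↦ idemRight_mul_idemRight P γ γ) hdef
  refine ⟨A, B, hA, hB', fun a ha c hc ↦ ?_, fun b hb c hc ↦ ?_, ?_⟩
  -- Stability of the nilpotent scalars comes from (a E_γ)(c N) = ac N.
  · rcases hA1 a ha with rfl | ⟨γ, hγ⟩
    · simpa using hc
    · simpa only [smul_mul_smul_comm, idemLeft_mul_nilp] using S.mul_mem hγ hc
  · rcases hB1 b hb with rfl | ⟨γ, hγ⟩
    · simpa using hc
    · simpa only [smul_mul_smul_comm, nilp_mul_idemRight, mul_comm] using S.mul_mem hc hγ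
  · ext x
    constructor
    · intro hx
      have h0 := zero_mem_of_image_proj hB
      rcases hB ▸ Set.mem_image_of_mem proj hx with h | h <;> rcases proj_mem_B.1 h with
        rfl | ⟨v, hv, u, hu, h⟩
      · exact .inr (.inr ⟨0, by simpa using h0, by simp⟩)
      · obtain rfl : u = _ := hu
        rcases h.eq_of_kernel with ⟨b, hb, φ, rfl, -⟩ | ⟨c, -, rfl, -⟩
        · have := (hBS (Units.mk0 b hb) φ).1 hx
          exact .inr (.inl ⟨_, this.1, _, this.2, rfl⟩)
        · exact .inr (.inr ⟨c, hx, rfl⟩)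
      · exact .inr (.inr ⟨0, by simpa using h0, by simp⟩)
      · obtain rfl : v = _ := hv
        rcases h.eq_of_image with ⟨a, ha, γ, rfl, -⟩ | ⟨c, -, rfl, -⟩
        · have := (hAS (Units.mk0 a ha) γ).1 hx
          exact .inl ⟨_, this.1, _, this.2, rfl⟩
        · exact .inr (.inr ⟨c, hx, rfl⟩)
    · rintro (⟨a, ha, γ, hγ, rfl⟩ | ⟨b, hb, φ, hφ, rfl⟩ | ⟨c, hc, rfl⟩)
      · exact (hAS a γ).2 ⟨ha, hγ⟩
      · exact (hBS b φ).2 ⟨hb, hφ⟩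
      · exact hc

theorem isIdem_idemLeft (γ : ℂ) : IsIdem (idemLeft P γ) :=
  ⟨(hasImageKernel_idemLeft P γ).ne_zero, idemLeft_mul_idemLeft P γ γ⟩

theorem isIdem_idemRight (φ : ℂ) : IsIdem (idemRight P φ) :=
  ⟨(hasImageKernel_idemRight P φ).ne_zero, idemRight_mul_idemRight P φ φ⟩

theorem eq_one_of_isIdem_smul {a : ℂ} (ha : a ≠ 0) {e : M2} (he : IsIdem e)
    (h : IsIdem (a • e)) : a = 1 := by
  have h2 := h.2
  rw [smul_mul_smul_comm, he.2] at h2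
  have := smul_left_injective ℂ he.1 h2
  simpa [ha] using this

theorem not_isIdem_smul_nilp (c : ℂ) : ¬ IsIdem (c • nilp P) := fun h ↦ by
  have h2 := h.2
  rw [smul_mul_smul_comm, nilp_mul_nilp, smul_zero] at h2
  exact h.1 h2.symm

/-- A nilpotent multiple is never idempotent, and a nonzero multiple of an idempotent is idempotent
only for the scalar 1. -/
theorem isIdem_and_proj_mem_left {e : M2} :
    IsIdem e ∧ proj e ∈ B {basePoint P} G ↔ ∃ γ, affinePoint P γ ∈ G ∧ e = idemLeft P γ := by
  constructor
  · rintro ⟨he, h⟩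
    rcases proj_mem_B.1 h with rfl | ⟨v, rfl, u, hu, h⟩
    · exact (he.1 rfl).elim
    · rcases h.eq_of_image with ⟨a, ha, γ, rfl, rfl⟩ | ⟨c, -, rfl, -⟩
      · exact ⟨γ, hu, by rw [eq_one_of_isIdem_smul ha (isIdem_idemLeft γ) he, one_smul]⟩
      · exact (not_isIdem_smul_nilp c he).elim
  · rintro ⟨γ, hγ, rfl⟩
    exact ⟨isIdem_idemLeft γ, proj_mem_B.2 (.inr ⟨_, rfl, _, hγ, hasImageKernel_idemLeft P γ⟩)⟩

theorem isIdem_and_proj_mem_right {e : M2} :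
    IsIdem e ∧ proj e ∈ B F {basePoint P} ↔ ∃ φ, affinePoint P φ ∈ F ∧ e = idemRight P φ := by
  constructor
  · rintro ⟨he, h⟩
    rcases proj_mem_B.1 h with rfl | ⟨v, hv, u, rfl, h⟩
    · exact (he.1 rfl).elim
    · rcases h.eq_of_kernel with ⟨a, ha, φ, rfl, rfl⟩ | ⟨c, -, rfl, -⟩
      · exact ⟨φ, hv, by rw [eq_one_of_isIdem_smul ha (isIdem_idemRight φ) he, one_smul]⟩
      · exact (not_isIdem_smul_nilp c he).elim
  · rintro ⟨φ, hφ, rfl⟩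
    exact ⟨isIdem_idemRight φ, proj_mem_B.2 (.inr ⟨_, hφ, _, rfl, hasImageKernel_idemRight P φ⟩)⟩

theorem scaledB_left (Z : Set ℂ) :
    scaledB Z {basePoint P} G =
      insert 0 {x | ∃ z ∈ Z, ∃ γ, affinePoint P γ ∈ G ∧ x = z • idemLeft P γ} := by
  ext x
  refine or_congr Iff.rfl (exists_congr fun z ↦ and_congr_right fun _ ↦ ⟨?_, ?_⟩)
  · rintro ⟨e, he, he', rfl⟩
    obtain ⟨γ, hγ, rfl⟩ := isIdem_and_proj_mem_left.1 ⟨he, he'⟩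
    exact ⟨γ, hγ, rfl⟩
  · rintro ⟨γ, hγ, rfl⟩
    have := isIdem_and_proj_mem_left.2 ⟨γ, hγ, rfl⟩
    exact ⟨_, this.1, this.2, rfl⟩

theorem scaledB_right (Z : Set ℂ) :
    scaledB Z F {basePoint P} =
      insert 0 {x | ∃ z ∈ Z, ∃ φ, affinePoint P φ ∈ F ∧ x = z • idemRight P φ} := by
  ext x
  refine or_congr Iff.rfl (exists_congr fun z ↦ and_congr_right fun _ ↦ ⟨?_, ?_⟩)
  · rintro ⟨e, he, he', rfl⟩
    obtain ⟨φ, hφ, rfl⟩ := isIdem_and_proj_mem_right.1 ⟨he, he'⟩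
    exact ⟨φ, hφ, rfl⟩
  · rintro ⟨φ, hφ, rfl⟩
    have := isIdem_and_proj_mem_right.2 ⟨φ, hφ, rfl⟩
    exact ⟨_, this.1, this.2, rfl⟩

theorem exists_eq_smul_nilp {A B : Subgroup ℂˣ} {G F C : Set ℂ} {x : M2}
    (hx : x ∈ triangular P A B G F C) (hnil : IsNil x) : ∃ c ∈ C, x = c • nilp P := by
  rcases hx with ⟨a, ha, γ, hγ, rfl⟩ | ⟨b, hb, φ, hφ, rfl⟩ | h
  · rw [IsNil, smul_mul_smul_comm, idemLeft_mul_idemLeft] at hnil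
    have := (hasImageKernel_idemLeft P γ).ne_zero
    simp [this] at hnil
  · rw [IsNil, smul_mul_smul_comm, idemRight_mul_idemRight] at hnil
    have := (hasImageKernel_idemRight P φ).ne_zero
    simp [this] at hnil
  · exact h

end TwoByTwo

/-! ### The main theorem -/

theorem propositionP (S : Subsemigroup M2) (hS : S ≤ M20) (hdef : IsInftyDefinable (S : Set M2))
    (v : P1) (F G : Set P1) (hB : proj '' (S : Set M2) = B F {v} ∪ B {v} G) :
    -- idempotents `e`, `f` and a nilpotent `n` of the required kind exist in `S`
    ((G \ {v}).Nonempty → ∃ e ∈ S, IsIdem e ∧ proj e ∈ B {v} G) ∧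
    ((F \ {v}).Nonempty → ∃ f ∈ S, IsIdem f ∧ proj f ∈ B F {v}) ∧
    (∃ n ∈ S, IsNil n ∧ (v ∈ F ∪ G → n ≠ 0)) ∧
    -- the nonzero nilpotents of `S` are unique up to a scalar
    (∀ n ∈ S, ∀ m ∈ S, IsNil n → n ≠ 0 → IsNil m → m ≠ 0 → ∃ z : ℂ, z ≠ 0 ∧ m = z • n) ∧
    -- the structure of `S`, for every choice of `e`, `f`, `n`
    -- (`e` is irrelevant when `G ⊆ {v}`, and `f` is irrelevant when `F ⊆ {v}`;
    -- `n` is nonzero, except when `v ∉ F ∪ G`, where zero is the only nilpotent in `S`)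
    (∀ e f n : M2,
      ((G \ {v}).Nonempty → IsIdem e ∧ proj e ∈ B {v} G) →
      ((F \ {v}).Nonempty → IsIdem f ∧ proj f ∈ B F {v}) →
      n ∈ S → IsNil n → (v ∈ F ∪ G → n ≠ 0) →
      (S : Set M2) =
        scaledB (Z S e) {v} (G \ {v}) ∪ scaledB (Z S f) (F \ {v}) {v} ∪
          {x | ∃ z ∈ Z S n, x = z • n}) ∧
    -- `S` is the intersection of a small family of definable semigroups of singular matrices
    (∃ (κ : Type) (T : κ → Subsemigroup M2), Cardinal.mk κ < Cardinal.continuum ∧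
      (∀ i, T i ≤ M20 ∧ IsDefinable (T i : Set M2)) ∧ (S : Set M2) = ⋂ i, (T i : Set M2)) := by
  obtain ⟨P, rfl⟩ := exists_basePoint_eq v
  have h0 := zero_mem_of_image_proj hB
  obtain ⟨A, A', hA, hA', hAC, hAC', hST⟩ := exists_eq_triangular hdef hB
  have hmem {x : M2} : x ∈ S ↔ x ∈ triangular P A A' {γ | idemLeft P γ ∈ S}
      {φ | idemRight P φ ∈ S} {c | c • nilp P ∈ S} := by rw [← hST, SetLike.mem_coe]
  have h0C : (0 : ℂ) ∈ {c : ℂ | c • nilp P ∈ S} := by simpa using h0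
  -- The condition on `a` does not involve `γ`, so Z_e is the same for every admissible `e`.
  have hleft {a γ : ℂ} (ha : a ≠ 0) : a • idemLeft P γ ∈ S ↔
      (∃ a' ∈ A, a = (a' : ℂ)) ∧ affinePoint P γ ∈ G := by
    rw [hmem, smul_idemLeft_mem_triangular P h0C, ← idemLeft_mem_iff hdef hB]
    simp [ha]
  have hright {b φ : ℂ} (hb : b ≠ 0) : b • idemRight P φ ∈ S ↔
      (∃ b' ∈ A', b = (b' : ℂ)) ∧ affinePoint P φ ∈ F := by
    rw [hmem, smul_idemRight_mem_triangular P h0C, ← idemRight_mem_iff hdef hB]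
    simp [hb]
  have hnil {n m : M2} (hn : n ∈ S) (hm : m ∈ S) (hn' : IsNil n) (hn0 : n ≠ 0) (hm' : IsNil m)
      (hm0 : m ≠ 0) : ∃ z : ℂ, z ≠ 0 ∧ m = z • n := by
    obtain ⟨c, -, rfl⟩ := exists_eq_smul_nilp (hmem.1 hn) hn'
    obtain ⟨d, -, rfl⟩ := exists_eq_smul_nilp (hmem.1 hm) hm'
    have hc := (smul_ne_zero_iff.1 hn0).1
    have hd := (smul_ne_zero_iff.1 hm0).1
    exact ⟨d / c, div_ne_zero hd hc, by rw [smul_smul, div_mul_cancel₀ _ hc]⟩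
  have hnilp (c : ℂ) : IsNil (c • nilp P) := by
    rw [IsNil, smul_mul_smul_comm, nilp_mul_nilp, smul_zero]
  refine ⟨?_, ?_, ?_, fun n hn m hm hn' hn0 hm' hm0 ↦ hnil hn hm hn' hn0 hm' hm0, ?_, ?_⟩
  · rintro ⟨u, hu, hne⟩
    obtain ⟨γ, rfl⟩ := exists_affinePoint_eq hne
    exact ⟨_, (idemLeft_mem_iff hdef hB).2 hu, isIdem_and_proj_mem_left.2 ⟨γ, hu, rfl⟩⟩
  · rintro ⟨u, hu, hne⟩
    obtain ⟨φ, rfl⟩ := exists_affinePoint_eq hne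
    exact ⟨_, (idemRight_mem_iff hdef hB).2 hu, isIdem_and_proj_mem_right.2 ⟨φ, hu, rfl⟩⟩
  · by_cases hv : basePoint P ∈ F ∪ G
    · obtain ⟨c, hc, hcS⟩ := (exists_smul_nilp_mem_iff hB).2 hv
      exact ⟨_, hcS, hnilp c, fun _ ↦ smul_ne_zero hc (hasImageKernel_nilp P).ne_zero⟩
    · exact ⟨0, h0, mul_zero 0, fun h ↦ (hv h).elim⟩
  · intro e f n he hf hn hn' hn0
    rw [scaledB_left, scaledB_right]
    ext x
    constructor
    · intro hx
      rcases hmem.1 hx with ⟨a, ha, γ, hγ, rfl⟩ | ⟨b, hb, φ, hφ, rfl⟩ | ⟨c, hc, rfl⟩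
      · have hγG := (idemLeft_mem_iff hdef hB).1 hγ
        have hγG' : affinePoint P γ ∈ G \ {basePoint P} := ⟨hγG, affinePoint_ne_basePoint P γ⟩
        obtain ⟨γ', hγ', rfl⟩ := isIdem_and_proj_mem_left.1 (he ⟨_, hγG'⟩)
        exact .inl (.inl (.inr ⟨a, ⟨a.ne_zero, (hleft a.ne_zero).2 ⟨⟨a, ha, rfl⟩, hγ'⟩⟩, γ, hγG',
          rfl⟩))
      · have hφF := (idemRight_mem_iff hdef hB).1 hφ
        have hφF' : affinePoint P φ ∈ F \ {basePoint P} := ⟨hφF, affinePoint_ne_basePoint P φ⟩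
        obtain ⟨φ', hφ', rfl⟩ := isIdem_and_proj_mem_right.1 (hf ⟨_, hφF'⟩)
        exact .inl (.inr (.inr ⟨b, ⟨b.ne_zero, (hright b.ne_zero).2 ⟨⟨b, hb, rfl⟩, hφ'⟩⟩, φ, hφF',
          rfl⟩))
      · rcases eq_or_ne c 0 with rfl | hc0
        · exact .inl (.inl (.inl (zero_smul _ _)))
        -- A nonzero nilpotent in `S` forces `v ∈ F ∪ G`, hence `n ≠ 0`.
        · have hn0 := hn0 ((exists_smul_nilp_mem_iff hB).1 ⟨c, hc0, hc⟩)
          obtain ⟨z, hz, h⟩ := hnil hn hx hn' hn0 (hnilp c)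
            (smul_ne_zero hc0 (hasImageKernel_nilp P).ne_zero)
          exact .inr ⟨z, ⟨hz, h ▸ hx⟩, h⟩
    · rintro (((rfl | ⟨z, ⟨hz, hzS⟩, γ, hγ, rfl⟩) | (rfl | ⟨z, ⟨hz, hzS⟩, φ, hφ, rfl⟩)) |
        ⟨z, ⟨hz, hzS⟩, rfl⟩)
      · exact h0
      · obtain ⟨γ', hγ', rfl⟩ := isIdem_and_proj_mem_left.1 (he ⟨_, hγ⟩)
        exact (hleft hz).2 ⟨((hleft hz).1 hzS).1, hγ.1⟩
      · exact h0
      · obtain ⟨φ', hφ', rfl⟩ := isIdem_and_proj_mem_right.1 (hf ⟨_, hφ⟩)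
        exact (hright hz).2 ⟨((hright hz).1 hzS).1, hφ.1⟩
      · exact hzS
  · rw [hST]
    refine exists_family_triangular P hA hA' ?_ ?_ ?_ h0C hAC hAC' fun γ hγ φ hφ ↦ ?_
    · have := hdef.isFiniteOrCosmall_line (idemLeft P 0) (-nilp P)
      simpa only [← idemLeft_eq_add, SetLike.mem_coe] using this
    · have := hdef.isFiniteOrCosmall_line (idemRight P 0) (nilp P)
      simpa only [← idemRight_eq_add, SetLike.mem_coe] using this
    · simpa using hdef.isFiniteOrCosmall_line 0 (nilp P)
    · have := S.mul_mem hγ hφ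
      rwa [idemLeft_mul_idemRight] at this
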